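/- A packing linear program has $n$ agents and $m$ resources; resource $j$ has capacity $c_j>0$. Agent $i$ has a finite set $O_i$ of options; option $o\in O_i$ has value $w_{io}\ge 0$ and needs $a_{ioj}\ge 0$ units of resource $j$. Let $q=\max_i|O_i|$, and let $OPT$ be the maximum of $\sum_{i}\sum_{o\in O_i}w_{io}x_{io}$ over all $x\ge 0$ with $\sum_{o\in O_i} x_{io}\le 1$ for every $i$ and $\sum_{i}\sum_{o\in O_i}a_{ioj}x_{io}\le c_j$ for every $j$. The agents arrive in a uniformly random order. Ties are resolved by a perturbation of the values: for working values $v=(v_{io})$ and prices $\alpha\in\mathbb R_{\ge 0}^m$, the gain of option $o$ for agent $i$ is $v_{io}-\sum_j\alpha_ja_{ioj}$, and the gain of leaving $i$ unassigned is $0$. Agent $i$ is tied at $\alpha$ if two different choices (options, or no assignment) have maximum gain, and $v$ is in general position if at most $m$ agents are tied at any $\alpha\ge 0$. Training-based primal-dual algorithm, with parameter $0<\varepsilon<1$: let $S$ be the first $\lfloor\varepsilon n\rfloor$ agents, which are only observed. Let $(\alpha^*,\beta^*)$ be an optimal solution of the sampled dual program: minimize $\sum_j\varepsilon c_j\alpha_j+\sum_{i\in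 S}\beta_i$ over $\alpha_j\ge 0$, $\beta_i\ge 0$ subject to $\sum_j\alpha_ja_{ioj}+\beta_i\ge v_{io}$ for all $i\in S$, $o\in O_i$. For each later agent, select a choice of maximum gain at the prices $\alpha^*$; the selected option is allocated if it fits in the remaining capacities, and skipped otherwise. **Theorem 5.** There is an absolute constant $C>0$ such that the following holds for every packing linear program and every $0<\varepsilon<1$ with $$w_{io}\,(m+1)(\ln n+\ln q)\le\varepsilon\, OPT\quad\text{and}\quad a_{ioj}\,(m+1)(\ln n+\ln q)\le\varepsilon^3c_j\qquad\text{for all } i,\ o\in O_i,\ j,$$ and for all working values $v$ in general position with $|v_{io}-w_{io}|\le\varepsilon\, OPT/n$ for all $i,o$ (one may take $v=w$ if $w$ is in general position). With probability at least $1-\frac{2}{nq}$ over the arrival order, for every choice of the optimal dual solution and of the options of maximum gain, the allocation made by the algorithm is feasible and has true value $\sum w_{io}\ge(1-C\varepsilon)\,OPT$; moreover, the options selected for all the agents outside $S$, when none is skipped, have total true value at least $(1-C\varepsilon)\,OPT$ and use at most $(1+C\varepsilon)c_j$ units of each resource $j$. -/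

import Mathlib

open Finset

/-- A packing linear program with `n` agents and `m` resources.  Agent `i` has `numOpt i` options;
option `o` of agent `i` has value `w i o` and needs `a i o j` units of resource `j`, of which
`c j` units are available. -/
structure PackingLP (n m : ℕ) where
  numOpt : Fin n → ℕ
  w : (i : Fin n) → Fin (numOpt i) → ℝ
  a : (i : Fin n) → Fin (numOpt i) → Fin m → ℝ
  c : Fin m → ℝ
  w_nonneg : ∀ i o, 0 ≤ w i o
  a_nonneg : ∀ i o j, 0 ≤ a i o j
  c_pos : ∀ j, 0 < c j

namespace PackingLP

variable {n m : ℕ} (P : PackingLP n m)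

/-- The maximum number of options of an agent. -/
def q : ℕ := univ.sup P.numOpt

/-- Feasibility of a fractional allocation `x`. -/
def Feasible (x : (i : Fin n) → Fin (P.numOpt i) → ℝ) : Prop :=
  (∀ i o, 0 ≤ x i o) ∧ (∀ i, ∑ o, x i o ≤ 1) ∧ ∀ j, ∑ i, ∑ o, x i o * P.a i o j ≤ P.c j

/-- The offline optimum of the packing linear program. -/
noncomputable def OPT : ℝ :=
  sSup {r : ℝ | ∃ x, P.Feasible x ∧ r = ∑ i, ∑ o, x i o * P.w i o}

/-- The values of feasible allocations are bounded, so that `OPT` is a genuine supremum. -/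
theorem bddAbove_values :
    BddAbove {r : ℝ | ∃ x, P.Feasible x ∧ r = ∑ i, ∑ o, x i o * P.w i o} := by
  refine ⟨∑ i, ∑ o, P.w i o, ?_⟩
  rintro r ⟨x, ⟨h0, h1, -⟩, rfl⟩
  refine sum_le_sum fun i _ => sum_le_sum fun o _ => ?_
  have h : x i o ≤ 1 :=
    (single_le_sum (f := fun o => x i o) (fun o _ => h0 i o) (mem_univ o)).trans (h1 i)
  exact mul_le_of_le_one_left (P.w_nonneg i o) h

/-- Values for the options of the agents; the true ones are `P.w`. -/
abbrev Values : Type := (i : Fin n) → Fin (P.numOpt i) → ℝ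

/-- `(α, β)` is feasible for the dual program on the set `S` of agents, with option values `v`. -/
def SampleDualFeasible (v : P.Values) (S : Finset (Fin n)) (α : Fin m → ℝ) (β : Fin n → ℝ) :
    Prop :=
  (∀ j, 0 ≤ α j) ∧ (∀ i ∈ S, 0 ≤ β i) ∧ ∀ i ∈ S, ∀ o, v i o ≤ ∑ j, α j * P.a i o j + β i

/-- Objective of the dual program on `S`, where capacity `c j` is replaced by `ε * c j`. -/
noncomputable def sampleDualObj (ε : ℝ) (S : Finset (Fin n)) (α : Fin m → ℝ) (β : Fin n → ℝ) :
    ℝ :=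
  ∑ j, ε * P.c j * α j + ∑ i ∈ S, β i

/-- `α` is the price part of an optimal solution of the sampled dual program. -/
def IsOptimalPrice (v : P.Values) (ε : ℝ) (S : Finset (Fin n)) (α : Fin m → ℝ) : Prop :=
  ∃ β, P.SampleDualFeasible v S α β ∧
    ∀ α' β', P.SampleDualFeasible v S α' β' → P.sampleDualObj ε S α β ≤ P.sampleDualObj ε S α' β'

/-- A choice for agent `i`: one of the options, or `none` (the agent is not assigned). -/
abbrev Choice (i : Fin n) : Type := Option (Fin (P.numOpt i))

/-- Gain of a choice at prices `α`; not assigning the agent has gain `0`. -/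
noncomputable def gain (v : P.Values) (α : Fin m → ℝ) (i : Fin n) : P.Choice i → ℝ
  | none => 0
  | some o => v i o - ∑ j, α j * P.a i o j

/-- A choice of maximum gain. In particular an option of negative gain is never chosen, and an
agent that has an option of positive gain is given one of maximum gain. -/
def IsBest (v : P.Values) (α : Fin m → ℝ) (i : Fin n) (x : P.Choice i) : Prop :=
  ∀ y, P.gain v α i y ≤ P.gain v α i x

/-- Agent `i` is tied at the prices `α`: it has two different choices of maximum gain. -/
def Tied (v : P.Values) (α : Fin m → ℝ) (i : Fin n) : Prop :=
  ∃ x y, x ≠ y ∧ P.IsBest v α i x ∧ P.IsBest v α i y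

/-- General position: no vector of prices makes more than `m` agents tied. -/
def GeneralPosition (v : P.Values) : Prop :=
  ∀ α : Fin m → ℝ, (∀ j, 0 ≤ α j) → {i | P.Tied v α i}.ncard ≤ m

/-- The true value of a choice. -/
def choiceValue (i : Fin n) : P.Choice i → ℝ
  | none => 0
  | some o => P.w i o

/-- The amount of resource `j` that a choice needs. -/
def choiceUse (j : Fin m) (i : Fin n) : P.Choice i → ℝ
  | none => 0
  | some o => P.a i o j

/-- Total true value when precisely the agents of `A` are served, each with the choice `sel i`. -/
noncomputable def value (sel : (i : Fin n) → P.Choice i) (A : Finset (Fin n)) : ℝ :=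
  ∑ i ∈ A, P.choiceValue i (sel i)

/-- Total use of resource `j` when precisely the agents of `A` are served. -/
noncomputable def usage (sel : (i : Fin n) → P.Choice i) (A : Finset (Fin n)) (j : Fin m) : ℝ :=
  ∑ i ∈ A, P.choiceUse j i (sel i)

open scoped Classical in
/-- The agents served among the first `t` arrivals, when agent `π p` arrives at position `p`: the
first `s` arrivals are only observed, and each later agent is served, with the choice `sel i`,
exactly if the remaining capacities allow it. -/
noncomputable def served (s : ℕ) (π : Equiv.Perm (Fin n)) (sel : (i : Fin n) → P.Choice i) :
    ℕ → Finset (Fin n)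
  | 0 => ∅
  | t + 1 =>
    if h : t < n then
      if s ≤ t ∧ ∀ j, P.usage sel (insert (π ⟨t, h⟩) (served s π sel t)) j ≤ P.c j then
        insert (π ⟨t, h⟩) (served s π sel t)
      else served s π sel t
    else served s π sel t

end PackingLP

/-- The first `s` agents in the arrival order `π`. -/
def firstAgents {n : ℕ} (s : ℕ) (π : Equiv.Perm (Fin n)) : Finset (Fin n) :=
  univ.filter fun i => (π.symm i : ℕ) < s

/-- The probability of an event under a uniformly random arrival order of `n` agents. -/
noncomputable def orderProb (n : ℕ) (E : Set (Equiv.Perm (Fin n))) : ℝ :=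
  (E.ncard : ℝ) / (n.factorial : ℝ)

/-! For a selection fixed in advance, the sample is a uniform random set of `⌊ε * n⌋` agents. Single
demands are tiny compared with the capacities, so the use of a resource by the sample is close to an
`ε` fraction of the total use, by a Chernoff bound for sampling without replacement
(`orderProb_arrivals_le`).

The prices depend on the sample, so a union bound over all selections that prices can induce is
needed. Best choices depend only on the signs of differences of gains, which are affine in the `m`
prices; the resulting family of patterns has VC dimension at most `m + 1`, and Sauer–Shelah bounds
their number by a polynomial of degree `m + 1` in `n * (q + 1) ^ 2` (`card_patterns_le`). The
smallness hypotheses make every bad event rarer than that.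

The rest is deterministic (`allocation_of_not_mem_badOrders`). Optimality of the prices on the
sample is approximate complementary slackness: the sample uses about `ε * c j` of every resource of
positive price, and no more of any other (`usage_untied_of_isOptimalPrice`). For a representative
order this extends to all agents, and weak duality makes the selection nearly optimal. General
position limits the effect of ties to `m` agents. The last `300 * ε * n` or so agents need more than
the excess over any capacity, so nobody before them is skipped; they and the sample carry only an
`O(ε)` part of the value. -/

/-! ### Concentration for uniform sampling without replacement. -/

/-- The term `k = s` of the binomial expansion of `(s + (n - s)) ^ n` is a largest one. -/
theorem choose_mul_pow_le_mode {n s : ℕ} (hs : s ≤ n) {k : ℕ} (hk : k ≤ n) :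
    n.choose k * (s ^ k * (n - s) ^ (n - k)) ≤ n.choose s * (s ^ s * (n - s) ^ (n - s)) := by
  -- The ratio of term `k + 1` to term `k` is `s (n - k) / ((k + 1) (n - s))`: at least 1 for `k <
  -- s`, at most 1 for `k ≥ s`. Multiplying by `k + 1` avoids division.
  have up : ∀ k, k < s → n.choose k * (s ^ k * (n - s) ^ (n - k)) ≤
      n.choose (k + 1) * (s ^ (k + 1) * (n - s) ^ (n - (k + 1))) := by
    intro k hk
    refine Nat.le_of_mul_le_mul_right (c := k + 1) ?_ (Nat.succ_pos k)
    obtain ⟨d, rfl⟩ : ∃ d, n = k + 1 + d := ⟨n - (k + 1), by omega⟩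
    have e1 : k + 1 + d - k = d + 1 := by omega
    have e2 : k + 1 + d - (k + 1) = d := by omega
    have hc := Nat.choose_succ_right_eq (k + 1 + d) k
    rw [e1] at hc
    rw [e1, e2]
    set D := k + 1 + d - s with hD
    have h1 : (k + 1) * D ≤ s * (d + 1) := Nat.mul_le_mul (by omega) (by omega)
    calc (k + 1 + d).choose k * (s ^ k * D ^ (d + 1)) * (k + 1)
        = ((k + 1 + d).choose k * (s ^ k * D ^ d)) * ((k + 1) * D) := by ring
      _ ≤ ((k + 1 + d).choose k * (s ^ k * D ^ d)) * (s * (d + 1)) := Nat.mul_le_mul_left _ h1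
      _ = ((k + 1 + d).choose k * (d + 1)) * (s ^ (k + 1) * D ^ d) := by ring
      _ = _ := by rw [← hc]; ring
  have down : ∀ k, s ≤ k → k + 1 ≤ n →
      n.choose (k + 1) * (s ^ (k + 1) * (n - s) ^ (n - (k + 1))) ≤
        n.choose k * (s ^ k * (n - s) ^ (n - k)) := by
    intro k hk hkn
    refine Nat.le_of_mul_le_mul_right (c := k + 1) ?_ (Nat.succ_pos k)
    obtain ⟨d, rfl⟩ : ∃ d, n = k + 1 + d := ⟨n - (k + 1), by omega⟩
    have e1 : k + 1 + d - k = d + 1 := by omega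
    have e2 : k + 1 + d - (k + 1) = d := by omega
    have hc := Nat.choose_succ_right_eq (k + 1 + d) k
    rw [e1] at hc
    rw [e1, e2]
    set D := k + 1 + d - s with hD
    have h1 : s * (d + 1) ≤ (k + 1) * D := Nat.mul_le_mul (by omega) (by omega)
    calc (k + 1 + d).choose (k + 1) * (s ^ (k + 1) * D ^ d) * (k + 1)
        = ((k + 1 + d).choose (k + 1) * (k + 1)) * (s ^ (k + 1) * D ^ d) := by ring
      _ = ((k + 1 + d).choose k * (s ^ k * D ^ d)) * (s * (d + 1)) := by rw [hc]; ring
      _ ≤ ((k + 1 + d).choose k * (s ^ k * D ^ d)) * ((k + 1) * D) := Nat.mul_le_mul_left _ h1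
      _ = _ := by ring
  rcases le_total k s with h | h
  · have key : ∀ d, d ≤ s → n.choose (s - d) * (s ^ (s - d) * (n - s) ^ (n - (s - d))) ≤
        n.choose s * (s ^ s * (n - s) ^ (n - s)) := by
      intro d
      induction d with
      | zero => simp
      | succ d ih =>
        intro hd
        have := up (s - (d + 1)) (by omega)
        rw [show s - (d + 1) + 1 = s - d by omega] at this
        exact this.trans (ih (by omega))
    have := key (s - k) (by omega)
    rwa [show s - (s - k) = k by omega] at this
  · induction k, h using Nat.le_induction with
    | base => exact le_rfl
    | succ k hsk ih => exact (down k hsk hk).trans (ih (by omega))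

/-- The largest of `n + 1` terms is at least their average. Thus a binomial variable with mean `s`
equals `s` with probability at least `1 / (n + 1)`, which is the price of replacing independent
sampling by a sample of fixed size. -/
theorem pow_self_le_choose_mul {n s : ℕ} (hs : s ≤ n) :
    n ^ n ≤ (n + 1) * (n.choose s * (s ^ s * (n - s) ^ (n - s))) := by
  have h := add_pow s (n - s) n
  rw [Nat.add_sub_cancel' hs] at h
  rw [h]
  calc _ ≤ ∑ _k ∈ range (n + 1), n.choose s * (s ^ s * (n - s) ^ (n - s)) := by
        refine sum_le_sum fun k hk => ?_
        have := choose_mul_pow_le_mode hs (Nat.lt_succ_iff.1 (mem_range.1 hk))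
        simpa [mul_comm, mul_assoc, mul_left_comm] using this
    _ = _ := by simp

/-- Comparison of sampling `s` of `n` elements with independent sampling. -/
theorem sum_powersetCard_prod_le {n s : ℕ} (hn : 0 < n) (hs : s ≤ n) (x : Fin n → ℝ) (θ : ℝ)
    (hx : ∀ i, 0 ≤ 1 + θ * x i) :
    ∑ T ∈ powersetCard s (univ : Finset (Fin n)), ∏ i ∈ T, (1 + θ * x i) ≤
      (n + 1) * n.choose s * Real.exp (θ * (s / n) * ∑ i, x i) := by
  set W : ℝ := (s : ℝ) ^ s * ((n - s : ℕ) : ℝ) ^ (n - s) with hW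
  have hn' : (0 : ℝ) < n := by exact_mod_cast hn
  have hWpos : 0 < W := by
    refine mul_pos ?_ ?_
    · rcases Nat.eq_zero_or_pos s with h | h
      · simp [h]
      · positivity
    · rcases Nat.eq_zero_or_pos (n - s) with h | h
      · simp [h]
      · positivity
  have hcast : ((n - s : ℕ) : ℝ) = n - s := by push_cast [hs]; ring
  -- The expanded product has one nonnegative term for each subset; those of size `s` share the
  -- weight `W`, and the others are dropped.
  have h1 : (∑ T ∈ powersetCard s (univ : Finset (Fin n)), ∏ i ∈ T, (1 + θ * x i)) * W ≤
      ∏ i, ((s : ℝ) * (1 + θ * x i) + ((n - s : ℕ) : ℝ)) := by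
    rw [Fintype.prod_add, sum_mul]
    calc _ = ∑ T ∈ powersetCard s (univ : Finset (Fin n)),
          (∏ i ∈ T, (s : ℝ) * (1 + θ * x i)) * ∏ _i ∈ Tᶜ, ((n - s : ℕ) : ℝ) := by
          refine sum_congr rfl fun T hT => ?_
          have hc : T.card = s := (mem_powersetCard.1 hT).2
          rw [prod_mul_distrib, prod_const, prod_const, card_compl, hc, Fintype.card_fin, hW]
          ring
      _ ≤ _ := by
          refine sum_le_sum_of_subset_of_nonneg (subset_univ _) fun T _ _ => ?_
          exact mul_nonneg (prod_nonneg fun i _ => mul_nonneg (by positivity) (hx i))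
            (prod_nonneg fun _ _ => by positivity)
  have h2 : ∏ i, ((s : ℝ) * (1 + θ * x i) + ((n - s : ℕ) : ℝ)) ≤
      (n : ℝ) ^ n * Real.exp (θ * (s / n) * ∑ i, x i) := by
    calc _ ≤ ∏ i, ((n : ℝ) * Real.exp (θ * (s / n) * x i)) := by
          refine prod_le_prod (fun i _ => ?_) fun i _ => ?_
          · exact add_nonneg (mul_nonneg (by positivity) (hx i)) (by positivity)
          · have := Real.add_one_le_exp (θ * (s / n) * x i)
            have h3 := mul_le_mul_of_nonneg_left this hn'.le
            refine le_trans (le_of_eq ?_) h3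
            rw [hcast]; field_simp; ring
      _ = _ := by
          rw [prod_mul_distrib, prod_const, ← Real.exp_sum, ← mul_sum]; simp
  have h3 : (n : ℝ) ^ n ≤ (n + 1) * (n.choose s * W) := by
    have := pow_self_le_choose_mul hs
    rw [hW]; exact_mod_cast this
  refine le_of_mul_le_mul_right ?_ hWpos
  calc _ ≤ _ := h1.trans h2
    _ ≤ ((n + 1) * (n.choose s * W)) * Real.exp (θ * (s / n) * ∑ i, x i) :=
        mul_le_mul_of_nonneg_right h3 (Real.exp_pos _).le
    _ = _ := by ring

/-- The agents that arrive at the positions in `B`. -/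
def arrivals {n : ℕ} (B : Finset (Fin n)) (π : Equiv.Perm (Fin n)) : Finset (Fin n) :=
  B.map π.toEmbedding

/-- Double counting of pairs `(T, π)`: for fixed `T`, precomposing `π` with a permutation that
carries `T` to `B` shows that the sum over `π` does not depend on `T`; for fixed `π`, the map `T ↦
π(T)` permutes the sets of this size. -/
theorem sum_perm_arrivals {n : ℕ} (B : Finset (Fin n)) (g : Finset (Fin n) → ℝ) :
    (n.choose B.card : ℝ) * ∑ π : Equiv.Perm (Fin n), g (arrivals B π) =
      n.factorial * ∑ T ∈ powersetCard B.card (univ : Finset (Fin n)), g T := by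
  have hconst : ∀ T ∈ powersetCard B.card (univ : Finset (Fin n)),
      ∑ π : Equiv.Perm (Fin n), g (arrivals T π) =
        ∑ π : Equiv.Perm (Fin n), g (arrivals B π) := by
    intro T hT
    have hc : T.card = B.card := (mem_powersetCard.1 hT).2
    obtain ⟨e⟩ : Nonempty ({x // x ∈ T} ≃ {x // x ∈ B}) := ⟨Finset.equivOfCardEq hc⟩
    have hτ : T.map e.extendSubtype.toEmbedding = B := by
      refine eq_of_subset_of_card_le (fun y hy => ?_) (by simp [hc])
      obtain ⟨x, hx, rfl⟩ := mem_map.1 hy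
      exact e.extendSubtype_mem x hx
    refine (Equiv.sum_comp (Equiv.mulRight e.extendSubtype) _).symm.trans ?_
    refine sum_congr rfl fun π _ => ?_
    congr 1
    simp only [arrivals, ← hτ, map_map]
    congr 1
  have h1 : ∑ T ∈ powersetCard B.card (univ : Finset (Fin n)),
      ∑ π : Equiv.Perm (Fin n), g (arrivals T π) =
        (n.choose B.card : ℝ) * ∑ π : Equiv.Perm (Fin n), g (arrivals B π) := by
    rw [sum_congr rfl hconst, sum_const, card_powersetCard]; simp
  rw [← h1, sum_comm]
  have h2 : ∀ π : Equiv.Perm (Fin n),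
      ∑ T ∈ powersetCard B.card (univ : Finset (Fin n)), g (arrivals T π) =
        ∑ T ∈ powersetCard B.card (univ : Finset (Fin n)), g T := by
    intro π
    refine sum_nbij' (fun T => T.map π.toEmbedding) (fun T => T.map π.symm.toEmbedding)
      ?_ ?_ ?_ ?_ ?_
    · intro T hT; simpa [mem_powersetCard] using hT
    · intro T hT; simpa [mem_powersetCard] using hT
    · intro T _; ext; simp
    · intro T _; ext; simp
    · intro T _; rfl
  rw [sum_congr rfl fun π _ => h2 π, sum_const]
  simp [Fintype.card_perm]

/-- By convexity the exponential lies below its chord on `[0, 1]`. This bounds the exponential of a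
sum by a product of affine factors, as `sum_powersetCard_prod_le` requires. -/
theorem exp_mul_le_one_add {x : ℝ} (l : ℝ) (h0 : 0 ≤ x) (h1 : x ≤ 1) :
    Real.exp (l * x) ≤ 1 + (Real.exp l - 1) * x := by
  have := convexOn_exp.2 (Set.mem_univ 0) (Set.mem_univ l) (sub_nonneg.2 h1) h0 (by ring)
  simp only [smul_eq_mul, Real.exp_zero, mul_zero, zero_add, mul_one] at this
  rw [mul_comm l x]; linarith

/-- Exponential moment of the sum over a random set of agents of fixed size. -/
theorem sum_perm_exp_le {n : ℕ} (hn : 0 < n) (B : Finset (Fin n)) (x : Fin n → ℝ)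
    (h0 : ∀ i, 0 ≤ x i) (h1 : ∀ i, x i ≤ 1) (l : ℝ) :
    ∑ π : Equiv.Perm (Fin n), Real.exp (l * ∑ i ∈ arrivals B π, x i) ≤
      n.factorial * ((n + 1) * Real.exp ((Real.exp l - 1) * (B.card / n) * ∑ i, x i)) := by
  have hle : B.card ≤ n := by simpa using card_le_univ B
  have hch : (0 : ℝ) < n.choose B.card := by exact_mod_cast Nat.choose_pos hle
  refine le_of_mul_le_mul_left ?_ hch
  rw [sum_perm_arrivals B fun T => Real.exp (l * ∑ i ∈ T, x i)]
  have hnn : ∀ i, Real.exp (l * x i) ≤ 1 + (Real.exp l - 1) * x i := fun i =>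
    exp_mul_le_one_add l (h0 i) (h1 i)
  have h2 := sum_powersetCard_prod_le hn hle x (Real.exp l - 1)
    fun i => (Real.exp_pos _).le.trans (hnn i)
  have h3 : ∑ T ∈ powersetCard B.card (univ : Finset (Fin n)), Real.exp (l * ∑ i ∈ T, x i) ≤
      ∑ T ∈ powersetCard B.card (univ : Finset (Fin n)),
        ∏ i ∈ T, (1 + (Real.exp l - 1) * x i) := by
    refine sum_le_sum fun T _ => ?_
    rw [mul_sum, Real.exp_sum]
    exact prod_le_prod (fun i _ => (Real.exp_pos _).le) fun i _ => hnn i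
  calc _ ≤ (n.factorial : ℝ) * _ := mul_le_mul_of_nonneg_left (h3.trans h2) (by positivity)
    _ = _ := by ring

/-- Chernoff bound, for both tails according to the sign of `l`. -/
theorem orderProb_arrivals_le {n : ℕ} (hn : 0 < n) (B : Finset (Fin n)) (x : Fin n → ℝ)
    (h0 : ∀ i, 0 ≤ x i) {A : ℝ} (hA : 0 < A) (h1 : ∀ i, x i ≤ A) (l t : ℝ) :
    orderProb n {π | l * t ≤ l * ∑ i ∈ arrivals B π, x i} ≤
      (n + 1) * Real.exp (((Real.exp l - 1) * (B.card / n * ∑ i, x i) - l * t) / A) := by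
  classical
  have hf : (0 : ℝ) < n.factorial := by exact_mod_cast n.factorial_pos
  rw [orderProb, div_le_iff₀ hf]
  have hmom := sum_perm_exp_le hn B (fun i => x i / A) (fun i => div_nonneg (h0 i) hA.le)
    (fun i => (div_le_one hA).2 (h1 i)) l
  set E : Finset (Equiv.Perm (Fin n)) :=
    univ.filter fun π => l * t ≤ l * ∑ i ∈ arrivals B π, x i with hE
  have hset : {π : Equiv.Perm (Fin n) | l * t ≤ l * ∑ i ∈ arrivals B π, x i} = ↑E := by
    ext; simp [hE]
  rw [hset, Set.ncard_coe_finset]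
  have h2 : (E.card : ℝ) * Real.exp (l * t / A) ≤
      ∑ π : Equiv.Perm (Fin n), Real.exp (l * ∑ i ∈ arrivals B π, x i / A) := by
    rw [← nsmul_eq_mul]
    refine (card_nsmul_le_sum E _ _ fun π hπ => ?_).trans
      (sum_le_sum_of_subset_of_nonneg (subset_univ E) fun _ _ _ => (Real.exp_pos _).le)
    rw [Real.exp_le_exp, ← sum_div, mul_div_assoc', div_le_div_iff_of_pos_right hA]
    exact (mem_filter.1 hπ).2
  have h3 := h2.trans hmom
  rw [← sum_div] at h3
  refine le_of_mul_le_mul_right (h3.trans (le_of_eq ?_)) (Real.exp_pos (l * t / A))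
  have : Real.exp (((Real.exp l - 1) * (B.card / n * ∑ i, x i) - l * t) / A) *
      Real.exp (l * t / A) =
      Real.exp ((Real.exp l - 1) * (B.card / n) * ((∑ i, x i) / A)) := by
    rw [← Real.exp_add]; congr 1; ring
  rw [← this]; ring

theorem orderProb_mono {n : ℕ} {E F : Set (Equiv.Perm (Fin n))} (h : E ⊆ F) :
    orderProb n E ≤ orderProb n F := by
  unfold orderProb
  gcongr
  exact F.toFinite

theorem orderProb_nonneg {n : ℕ} (E : Set (Equiv.Perm (Fin n))) : 0 ≤ orderProb n E := by
  unfold orderProb; positivity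

theorem orderProb_compl {n : ℕ} (E : Set (Equiv.Perm (Fin n))) :
    orderProb n Eᶜ = 1 - orderProb n E := by
  have hf : (n.factorial : ℝ) ≠ 0 := by exact_mod_cast n.factorial_ne_zero
  have h := Set.ncard_add_ncard_compl E
  rw [Nat.card_eq_fintype_card, Fintype.card_perm, Fintype.card_fin] at h
  unfold orderProb
  rw [eq_sub_iff_add_eq, ← add_div, div_eq_one_iff_eq hf]
  exact_mod_cast (by omega : Eᶜ.ncard + E.ncard = n.factorial)

theorem orderProb_biUnion_le {n : ℕ} {ι : Type*} (s : Finset ι)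
    (E : ι → Set (Equiv.Perm (Fin n))) :
    orderProb n (⋃ i ∈ s, E i) ≤ ∑ i ∈ s, orderProb n (E i) := by
  unfold orderProb
  rw [← sum_div]
  gcongr
  exact_mod_cast Finset.set_ncard_biUnion_le s E

theorem orderProb_union_le {n : ℕ} (E F : Set (Equiv.Perm (Fin n))) :
    orderProb n (E ∪ F) ≤ orderProb n E + orderProb n F := by
  unfold orderProb
  rw [← add_div]
  gcongr
  exact_mod_cast Set.ncard_union_le E F

/-! ### Counting the selections that prices can induce. -/

/-- Sauer–Shelah bound for a family of bounded Vapnik–Chervonenkis dimension. -/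
theorem card_le_pow_of_vcDim_le {α : Type*} [DecidableEq α] [Fintype α]
    (𝒜 : Finset (Finset α)) {d : ℕ} (h : 𝒜.vcDim ≤ d) :
    𝒜.card ≤ (Fintype.card α + 1) ^ d := by
  refine (card_le_card_shatterer 𝒜).trans (card_shatterer_le_sum_vcDim.trans ?_)
  calc ∑ k ∈ Iic 𝒜.vcDim, (Fintype.card α).choose k
      ≤ ∑ k ∈ range (d + 1), (Fintype.card α).choose k :=
        sum_le_sum_of_subset fun k hk => by
          have := mem_Iic.1 hk
          exact mem_range.2 (by omega)
    _ ≤ ∑ k ∈ range (d + 1), Fintype.card α ^ k * 1 ^ (d - k) * d.choose k := by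
        refine sum_le_sum fun k hk => ?_
        have : 0 < d.choose k := Nat.choose_pos (Nat.lt_succ_iff.1 (mem_range.1 hk))
        calc (Fintype.card α).choose k ≤ Fintype.card α ^ k * 1 := by
              simpa using Nat.choose_le_pow _ _
          _ ≤ _ := by rw [one_pow, mul_assoc, one_mul]; exact Nat.mul_le_mul_left _ this
    _ = _ := (add_pow _ _ _).symm

/-- The sets on which a function of the form `b k + ∑ j, α j * g k j`, with parameter `α`, is
positive do not shatter more than `m + 1` points. -/
theorem vcDim_affine_le {ι : Type*} [DecidableEq ι] {m : ℕ} (b : ι → ℝ) (g : ι → Fin m → ℝ)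
    (𝒜 : Finset (Finset ι))
    (h𝒜 : ∀ p ∈ 𝒜, ∃ α : Fin m → ℝ, ∀ k, k ∈ p ↔ 0 < b k + ∑ j, α j * g k j) :
    𝒜.vcDim ≤ m + 1 := by
  refine Finset.sup_le fun D hD => ?_
  have hsh : 𝒜.Shatters D := mem_shatterer.1 hD
  by_contra hlt
  push Not at hlt
  have hfin : Module.finrank ℝ (Option (Fin m) → ℝ) < Fintype.card D := by
    simpa using hlt
  have hdep : ¬ LinearIndependent ℝ
      (fun k : D => (fun o : Option (Fin m) => o.elim (b k) (g k))) := fun hli =>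
    absurd hli.fintype_card_le_finrank (not_le.2 hfin)
  obtain ⟨c, hc0, k0, hk0⟩ := Fintype.not_linearIndependent_iff.1 hdep
  -- More than `m + 1` vectors `(b k, g k)` are dependent. Shattering yields an `α` whose affine
  -- values are positive exactly where `c k > 0`; the combination with coefficients `c` is then
  -- positive, though dependence makes it zero. A negative coefficient is treated by negating `c`.
  have main : ∀ c : D → ℝ,
      (∑ k, c k • (fun o : Option (Fin m) => o.elim (b k) (g k)) = 0) →
      ∀ k0, ¬ 0 < c k0 := by
    intro c hc k0 hk0
    obtain ⟨p, hp, hDp⟩ := hsh (t := D.attach.filter (fun k => 0 < c k) |>.map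
      (Function.Embedding.subtype _)) (by
        intro k hk
        obtain ⟨x, -, rfl⟩ := mem_map.1 hk
        exact x.2)
    obtain ⟨α, hα⟩ := h𝒜 p hp
    have hmem : ∀ k : D, 0 < b k + ∑ j, α j * g k j ↔ 0 < c k := by
      intro k
      rw [← hα]
      have h1 : (k : ι) ∈ D ∩ p ↔ (k : ι) ∈ p := by simp [k.2]
      rw [← h1, hDp]
      simp
    have hb : ∑ k, c k * b k = 0 := by
      have := congrFun hc none
      simpa using this
    have hg : ∀ j, ∑ k, c k * g k j = 0 := by
      intro j
      have := congrFun hc (some j)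
      simpa using this
    have hzero : ∑ k : D, c k * (b k + ∑ j, α j * g k j) = 0 := by
      have : ∑ k : D, c k * ∑ j, α j * g k j = ∑ j, α j * ∑ k : D, c k * g k j := by
        simp_rw [mul_sum]
        rw [sum_comm]
        exact sum_congr rfl fun j _ => sum_congr rfl fun k _ => by ring
      simp_rw [mul_add, sum_add_distrib]
      rw [hb, this, zero_add]
      exact sum_eq_zero fun j _ => by rw [hg j, mul_zero]
    have hpos : 0 < ∑ k : D, c k * (b k + ∑ j, α j * g k j) := by
      refine sum_pos' (fun k _ => ?_) ⟨k0, mem_univ _, mul_pos hk0 ((hmem k0).2 hk0)⟩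
      rcases lt_or_ge 0 (c k) with h | h
      · exact (mul_pos h ((hmem k).2 h)).le
      · exact mul_nonneg_of_nonpos_of_nonpos h (not_lt.1 fun h' => absurd ((hmem k).1 h') h.not_gt)
    exact hpos.ne' hzero
  rcases lt_or_gt_of_ne hk0 with h | h
  · refine main (fun k => - c k) ?_ k0 (by simpa using h)
    simp only [neg_smul, sum_neg_distrib, hc0, neg_zero]
  · exact main c hc0 k0 h

namespace PackingLP

variable {n m : ℕ} (P : PackingLP n m)

/-- Pairs of choices of one agent. -/
abbrev ChoicePair : Type := Σ i : Fin n, P.Choice i × P.Choice i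

open scoped Classical in
/-- The pairs of choices of which the second has larger gain. -/
noncomputable def pattern (v : P.Values) (α : Fin m → ℝ) : Finset P.ChoicePair :=
  univ.filter fun k => P.gain v α k.1 k.2.1 < P.gain v α k.1 k.2.2

open scoped Classical in
/-- The patterns of all price vectors. -/
noncomputable def patterns (v : P.Values) : Finset (Finset P.ChoicePair) :=
  univ.filter fun p => ∃ α, p = P.pattern v α

open scoped Classical in
/-- For every agent a choice that is best according to a pattern. -/
noncomputable def bestOf (p : Finset P.ChoicePair) (i : Fin n) : P.Choice i :=
  if h : ∃ x : P.Choice i, ∀ y, (⟨i, x, y⟩ : P.ChoicePair) ∉ p then h.choose else none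

theorem pattern_mem_patterns (v : P.Values) (α : Fin m → ℝ) : P.pattern v α ∈ P.patterns v := by
  simp only [patterns, mem_filter, mem_univ, true_and]
  exact ⟨α, rfl⟩

/-- The selection is read off the pattern alone, so finitely many selections serve all prices. A
maximizer of the gain meets the condition in `bestOf`, so the default `none` is not used here. -/
theorem isBest_bestOf (v : P.Values) (α : Fin m → ℝ) (i : Fin n) :
    P.IsBest v α i (P.bestOf (P.pattern v α) i) := by
  have h : ∃ x : P.Choice i, ∀ y, (⟨i, x, y⟩ : P.ChoicePair) ∉ P.pattern v α := by
    obtain ⟨x, hx⟩ := Finite.exists_max (P.gain v α i)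
    exact ⟨x, fun y => by simpa [pattern] using hx y⟩
  intro y
  have := h.choose_spec y
  simp only [bestOf, dif_pos h]
  simpa [pattern] using this

theorem gain_eq (v : P.Values) (α : Fin m → ℝ) (i : Fin n) (x : P.Choice i) :
    P.gain v α i x = x.elim 0 (v i) - ∑ j, α j * P.choiceUse j i x := by
  cases x <;> simp [gain, choiceUse]

theorem numOpt_le_q (i : Fin n) : P.numOpt i ≤ P.q := le_sup (mem_univ i)

theorem card_choicePair_le : Fintype.card P.ChoicePair ≤ n * (P.q + 1) ^ 2 := by
  rw [Fintype.card_sigma]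
  calc _ ≤ ∑ _i : Fin n, (P.q + 1) ^ 2 := by
        refine sum_le_sum fun i _ => ?_
        have := P.numOpt_le_q i
        simp only [Fintype.card_prod, Fintype.card_option, Fintype.card_fin]
        rw [← sq]
        gcongr
    _ = _ := by simp

/-- A pair belongs to the pattern of `α` exactly if the difference of the two gains, affine in `α`,
is positive; hence `vcDim_affine_le` applies. -/
theorem card_patterns_le (v : P.Values) :
    (P.patterns v).card ≤ (n * (P.q + 1) ^ 2 + 1) ^ (m + 1) := by
  classical
  have h : (P.patterns v).vcDim ≤ m + 1 := by
    refine vcDim_affine_le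
      (fun k : P.ChoicePair => k.2.2.elim 0 (v k.1) - k.2.1.elim 0 (v k.1))
      (fun k j => P.choiceUse j k.1 k.2.1 - P.choiceUse j k.1 k.2.2) _ fun p hp => ?_
    obtain ⟨α, rfl⟩ := (mem_filter.1 hp).2
    refine ⟨α, fun k => ?_⟩
    simp only [pattern, mem_filter, mem_univ, true_and, gain_eq, mul_sub, sum_sub_distrib]
    constructor <;> intro h <;> linarith
  refine (card_le_pow_of_vcDim_le _ h).trans ?_
  gcongr
  exact P.card_choicePair_le

end PackingLP

/-! ### Linear programming duality and best choices. -/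

namespace PackingLP

variable {n m : ℕ} (P : PackingLP n m)

theorem choiceUse_nonneg (j : Fin m) (i : Fin n) (x : P.Choice i) : 0 ≤ P.choiceUse j i x := by
  cases x
  · exact le_rfl
  · exact P.a_nonneg _ _ _

theorem choiceValue_nonneg (i : Fin n) (x : P.Choice i) : 0 ≤ P.choiceValue i x := by
  cases x
  · exact le_rfl
  · exact P.w_nonneg _ _

theorem choiceUse_le {j : Fin m} {A : ℝ} (hA : 0 ≤ A) (h : ∀ i o, P.a i o j ≤ A) (i : Fin n)
    (x : P.Choice i) : P.choiceUse j i x ≤ A := by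
  cases x
  · exact hA
  · exact h _ _

theorem choiceValue_le {A : ℝ} (hA : 0 ≤ A) (h : ∀ i o, P.w i o ≤ A) (i : Fin n)
    (x : P.Choice i) : P.choiceValue i x ≤ A := by
  cases x
  · exact hA
  · exact h _ _

theorem zero_feasible : P.Feasible fun _ _ => 0 := by
  refine ⟨fun _ _ => le_rfl, fun i => by simp, fun j => by simpa using (P.c_pos j).le⟩

theorem le_OPT {x : (i : Fin n) → Fin (P.numOpt i) → ℝ} (hx : P.Feasible x) :
    ∑ i, ∑ o, x i o * P.w i o ≤ P.OPT :=
  le_csSup P.bddAbove_values ⟨x, hx, rfl⟩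

theorem OPT_nonneg : 0 ≤ P.OPT := by
  simpa using P.le_OPT P.zero_feasible

theorem OPT_le {r : ℝ} (h : ∀ x, P.Feasible x → ∑ i, ∑ o, x i o * P.w i o ≤ r) : P.OPT ≤ r := by
  refine csSup_le ⟨_, _, P.zero_feasible, rfl⟩ ?_
  rintro _ ⟨x, hx, rfl⟩
  exact h x hx

theorem sum_mul_le_of_sum_le_one {k : ℕ} {x y : Fin k → ℝ} {M : ℝ} (h0 : ∀ o, 0 ≤ x o)
    (h1 : ∑ o, x o ≤ 1) (hM : 0 ≤ M) (hy : ∀ o, y o ≤ M) : ∑ o, x o * y o ≤ M :=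
  calc ∑ o, x o * y o ≤ ∑ o, x o * M := sum_le_sum fun o _ =>
        mul_le_mul_of_nonneg_left (hy o) (h0 o)
    _ = (∑ o, x o) * M := by rw [sum_mul]
    _ ≤ 1 * M := mul_le_mul_of_nonneg_right h1 hM
    _ = M := one_mul M

theorem OPT_le_card_mul {W : ℝ} (hW : 0 ≤ W) (h : ∀ i o, P.w i o ≤ W) : P.OPT ≤ n * W := by
  refine P.OPT_le fun x hx => ?_
  calc _ ≤ ∑ _i : Fin n, W := sum_le_sum fun i _ =>
        sum_mul_le_of_sum_le_one (hx.1 i) (hx.2.1 i) hW (h i)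
    _ = _ := by simp

/-- A selection that uses every capacity at most twice has value at most `2 * OPT`. -/
theorem value_le_two_mul_OPT (sel : (i : Fin n) → P.Choice i)
    (h : ∀ j, P.usage sel univ j ≤ 2 * P.c j) : P.value sel univ ≤ 2 * P.OPT := by
  classical
  have key : ∀ (i : Fin n) (f : Fin (P.numOpt i) → ℝ),
      ∑ o, (if sel i = some o then (1 / 2 : ℝ) else 0) * f o = (sel i).elim 0 f / 2 := by
    intro i f
    rcases hs : sel i with _ | o'
    · simp
    · simp [ite_mul]; ring
  -- Taking half of every selected option is a feasible fractional allocation.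
  have hfeas : P.Feasible fun i o => if sel i = some o then (1 / 2 : ℝ) else 0 := by
    refine ⟨fun i o => by positivity, fun i => ?_, fun j => ?_⟩
    · have := key i fun _ => 1
      simp only [mul_one] at this
      rw [this]
      cases sel i <;> norm_num
    · have h2 : ∑ i, ∑ o, (if sel i = some o then (1 / 2 : ℝ) else 0) * P.a i o j =
          P.usage sel univ j / 2 := by
        rw [usage, sum_div]
        refine sum_congr rfl fun i _ => ?_
        rw [key i fun o => P.a i o j]
        cases sel i <;> rfl
      rw [h2]; linarith [h j]
  have h1 := P.le_OPT hfeas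
  have h2 : ∑ i, ∑ o, (if sel i = some o then (1 / 2 : ℝ) else 0) * P.w i o =
      P.value sel univ / 2 := by
    rw [value, sum_div]
    refine sum_congr rfl fun i _ => ?_
    rw [key i fun o => P.w i o]
    cases sel i <;> rfl
  rw [h2] at h1; linarith

theorem gain_nonneg_of_isBest {v : P.Values} {α : Fin m → ℝ} {i : Fin n} {x : P.Choice i}
    (h : P.IsBest v α i x) : 0 ≤ P.gain v α i x := h none

/-- Weak duality, with working values that differ from the true ones by at most `δ`. -/
theorem OPT_le_dual {v : P.Values} {α : Fin m → ℝ} (hα : ∀ j, 0 ≤ α j) {δ : ℝ} (hδ : 0 ≤ δ)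
    (hv : ∀ i o, |v i o - P.w i o| ≤ δ) {sel : (i : Fin n) → P.Choice i}
    (hsel : ∀ i, P.IsBest v α i (sel i)) :
    P.OPT ≤ ∑ i, P.gain v α i (sel i) + ∑ j, α j * P.c j + n * δ := by
  refine P.OPT_le fun x hx => ?_
  have h1 : ∀ i, ∑ o, x i o * P.w i o ≤
      P.gain v α i (sel i) + δ + ∑ o, x i o * ∑ j, α j * P.a i o j := by
    intro i
    have : ∑ o, x i o * (P.w i o - ∑ j, α j * P.a i o j) ≤ P.gain v α i (sel i) + δ := by
      refine sum_mul_le_of_sum_le_one (hx.1 i) (hx.2.1 i)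
        (add_nonneg (P.gain_nonneg_of_isBest (hsel i)) hδ) fun o => ?_
      have h2 := hsel i (some o)
      have h3 := (abs_le.1 (hv i o)).1
      simp only [gain] at h2 ⊢
      linarith
    simp only [mul_sub, sum_sub_distrib] at this
    linarith
  have h2 : ∑ i, ∑ o, x i o * ∑ j, α j * P.a i o j ≤ ∑ j, α j * P.c j := by
    have : ∑ i, ∑ o, x i o * ∑ j, α j * P.a i o j =
        ∑ j, α j * ∑ i, ∑ o, x i o * P.a i o j := by
      simp_rw [mul_sum]
      refine Eq.trans (sum_congr rfl fun i _ => sum_comm) (sum_comm.trans ?_)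
      refine sum_congr rfl fun j _ => sum_congr rfl fun i _ => sum_congr rfl fun o _ => ?_
      ring
    rw [this]
    exact sum_le_sum fun j _ => mul_le_mul_of_nonneg_left (hx.2.2 j) (hα j)
  calc _ ≤ ∑ i, (P.gain v α i (sel i) + δ + ∑ o, x i o * ∑ j, α j * P.a i o j) :=
        sum_le_sum fun i _ => h1 i
    _ ≤ _ := by
        simp only [sum_add_distrib, sum_const, card_univ, Fintype.card_fin, nsmul_eq_mul]
        linarith

/-- The working value of a selection, split into gains and payments. -/
theorem sum_workValue_eq (v : P.Values) (α : Fin m → ℝ) (sel : (i : Fin n) → P.Choice i) :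
    ∑ i, (sel i).elim 0 (v i) =
      ∑ i, P.gain v α i (sel i) + ∑ j, α j * P.usage sel univ j := by
  simp only [gain_eq, sum_sub_distrib, usage, mul_sum]
  rw [sum_comm (s := univ (α := Fin m))]
  ring

theorem abs_workValue_sub_le {v : P.Values} {δ : ℝ} (hδ : 0 ≤ δ)
    (hv : ∀ i o, |v i o - P.w i o| ≤ δ) (sel : (i : Fin n) → P.Choice i) :
    |∑ i, (sel i).elim 0 (v i) - P.value sel univ| ≤ n * δ := by
  rw [value, ← sum_sub_distrib]
  refine (abs_sum_le_sum_abs _ _).trans ?_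
  calc _ ≤ ∑ _i : Fin n, δ := sum_le_sum fun i _ => by
        cases h : sel i with
        | none => simpa [choiceValue] using hδ
        | some o => exact hv i o
    _ = _ := by simp

/-- Selections of best choices differ only on the tied agents. -/
theorem sum_le_sum_add_of_isBest {v : P.Values} (hv : P.GeneralPosition v) {α : Fin m → ℝ}
    (hα : ∀ j, 0 ≤ α j) {sel sel' : (i : Fin n) → P.Choice i}
    (hsel : ∀ i, P.IsBest v α i (sel i)) (hsel' : ∀ i, P.IsBest v α i (sel' i))
    (f : (i : Fin n) → P.Choice i → ℝ) {M : ℝ} (hM : 0 ≤ M) (h0 : ∀ i x, 0 ≤ f i x)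
    (h1 : ∀ i x, f i x ≤ M) (A : Finset (Fin n)) :
    ∑ i ∈ A, f i (sel i) ≤ ∑ i ∈ A, f i (sel' i) + m * M := by
  classical
  have hcard : ((A.filter fun i => P.Tied v α i).card : ℝ) ≤ m := by
    have h2 := hv α hα
    rw [Set.ncard_eq_toFinset_card'] at h2
    refine Nat.cast_le.2 (le_trans (card_le_card fun i hi => ?_) h2)
    simpa using (mem_filter.1 hi).2
  have h2 : ∀ i ∈ A, f i (sel i) ≤ f i (sel' i) + if P.Tied v α i then M else 0 := by
    intro i _
    split_ifs with h
    · linarith [h0 i (sel' i), h1 i (sel i)]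
    · have : sel i = sel' i := by
        by_contra hne
        exact h ⟨_, _, hne, hsel i, hsel' i⟩
      rw [this, add_zero]
  refine (sum_le_sum h2).trans ?_
  rw [sum_add_distrib, ← sum_filter, sum_const, nsmul_eq_mul]
  gcongr

/-! ### Approximate complementary slackness on the sample. -/

/-- First-order optimality of the prices in direction `d` of coordinate `j`. -/
theorem usage_untied_of_isOptimalPrice {v : P.Values} {ε : ℝ} {S : Finset (Fin n)}
    {α : Fin m → ℝ} (h : P.IsOptimalPrice v ε S α) {sel : (i : Fin n) → P.Choice i}
    (hsel : ∀ i, P.IsBest v α i (sel i)) (hv : P.GeneralPosition v) {j : Fin m} {A : ℝ}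
    (hA : 0 ≤ A) (hle : ∀ i x, P.choiceUse j i x ≤ A) {d : ℝ} (hd : |d| ≤ 1)
    (hdir : 0 ≤ d ∨ 0 < α j) :
    d * P.usage sel S j ≤ d * (ε * P.c j) + 2 * (m * A) := by
  classical
  obtain ⟨β, ⟨hα, hβ, hfeas⟩, hopt⟩ := h
  set Td := S.filter fun i => P.Tied v α i with hTd
  have hcard : (Td.card : ℝ) ≤ m := by
    have h2 := hv α hα
    rw [Set.ncard_eq_toFinset_card'] at h2
    refine Nat.cast_le.2 (le_trans (card_le_card fun i hi => ?_) h2)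
    simpa using (mem_filter.1 hi).2
  have hgain : ∀ (δ : ℝ) (i : Fin n) (x : P.Choice i),
      P.gain v (Function.update α j (α j + δ * d)) i x =
        P.gain v α i x - δ * d * P.choiceUse j i x := by
    intro δ i x
    rw [gain_eq, gain_eq, sub_sub]
    congr 1
    rw [← add_sum_erase _ _ (mem_univ j), ← add_sum_erase (a := j) univ
      (fun k => α k * P.choiceUse k i x) (mem_univ j), Function.update_self]
    have : ∑ k ∈ univ.erase j, Function.update α j (α j + δ * d) k * P.choiceUse k i x =
        ∑ k ∈ univ.erase j, α k * P.choiceUse k i x :=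
      sum_congr rfl fun k hk => by rw [Function.update_of_ne (ne_of_mem_erase hk)]
    rw [this]; ring
  -- The perturbed price must stay nonnegative, so it may be lowered only if `α j > 0`.
  have hsmall : ∀ᶠ δ in nhdsWithin (0 : ℝ) (Set.Ioi 0), 0 ≤ α j + δ * d := by
    rcases hdir with hd0 | hpos
    · filter_upwards [self_mem_nhdsWithin] with δ hδ
      exact add_nonneg (hα j) (mul_nonneg (le_of_lt hδ) hd0)
    · have ht : Filter.Tendsto (fun δ : ℝ => α j + δ * d) (nhds 0) (nhds (α j + 0 * d)) :=
        Continuous.tendsto (by fun_prop) 0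
      rw [zero_mul, add_zero] at ht
      exact nhdsWithin_le_nhds ((ht.eventually_const_lt hpos).mono fun _ => le_of_lt)
  -- The best choice of an untied agent is strictly best, hence survives a small change of price.
  have huntied : ∀ᶠ δ in nhdsWithin (0 : ℝ) (Set.Ioi 0), ∀ i, ¬ P.Tied v α i →
      ∀ y, P.gain v α i y - δ * d * P.choiceUse j i y ≤
        P.gain v α i (sel i) - δ * d * P.choiceUse j i (sel i) := by
    refine Filter.eventually_all.2 fun i => ?_
    by_cases hi : P.Tied v α i
    · exact Filter.Eventually.of_forall fun δ h => absurd hi h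
    suffices h : ∀ᶠ δ in nhdsWithin (0 : ℝ) (Set.Ioi 0), ∀ y,
        P.gain v α i y - δ * d * P.choiceUse j i y ≤
          P.gain v α i (sel i) - δ * d * P.choiceUse j i (sel i) from h.mono fun _ h _ => h
    refine Filter.eventually_all.2 fun y => ?_
    by_cases hy : y = sel i
    · exact Filter.Eventually.of_forall fun δ => by rw [hy]
    have hlt : P.gain v α i y < P.gain v α i (sel i) := by
      refine lt_of_le_of_ne (hsel i y) fun heq => hi ⟨y, sel i, hy, fun z => ?_, hsel i⟩
      rw [heq]; exact hsel i z
    have ht : Filter.Tendsto (fun δ : ℝ => P.gain v α i (sel i) - P.gain v α i y +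
        δ * (d * (P.choiceUse j i y - P.choiceUse j i (sel i)))) (nhds 0)
        (nhds (P.gain v α i (sel i) - P.gain v α i y +
        0 * (d * (P.choiceUse j i y - P.choiceUse j i (sel i))))) :=
      Continuous.tendsto (by fun_prop) 0
    rw [zero_mul, add_zero] at ht
    refine nhdsWithin_le_nhds ((ht.eventually_const_lt (sub_pos.2 hlt)).mono fun δ h => ?_)
    nlinarith
  obtain ⟨δ, ⟨hδ1, hδ2⟩, hδ⟩ := ((hsmall.and huntied).and self_mem_nhdsWithin).exists
  have hδ0 : (0 : ℝ) < δ := hδ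
  -- A feasible dual response to the new price: an untied agent follows its unchanged best choice,
  -- while the gain of a tied agent rises by at most `δ * A` whatever it chooses.
  set β' : Fin n → ℝ := fun i => P.gain v α i (sel i) +
    if P.Tied v α i then δ * A else - (δ * d * P.choiceUse j i (sel i)) with hβ'
  have hbound : ∀ i y, P.gain v (Function.update α j (α j + δ * d)) i y ≤ β' i := by
    intro i y
    rw [hgain, hβ']
    dsimp only
    split_ifs with hi
    · have h1 := hsel i y
      have h2 : -(d * P.choiceUse j i y) ≤ A := by
        have h3 := P.choiceUse_nonneg j i y
        have h4 : -d ≤ 1 := by linarith [(abs_le.1 hd).1]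
        nlinarith [hle i y]
      nlinarith
    · linarith [hδ2 i hi y]
  have hfeas' : P.SampleDualFeasible v S (Function.update α j (α j + δ * d)) β' := by
    refine ⟨fun k => ?_, fun i _ => hbound i none, fun i _ o => ?_⟩
    · rcases eq_or_ne k j with rfl | hk
      · rw [Function.update_self]; exact hδ1
      · rw [Function.update_of_ne hk]; exact hα k
    · have := hbound i (some o)
      simp only [gain] at this
      linarith
  have hobj := hopt _ _ hfeas'
  have hβsum : ∑ i ∈ S, P.gain v α i (sel i) ≤ ∑ i ∈ S, β i := by
    refine sum_le_sum fun i hi => ?_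
    rcases hs : sel i with _ | o
    · exact hβ i hi
    · have := hfeas i hi o
      simp only [gain]; linarith
  have hβ'sum : ∑ i ∈ S, β' i ≤ ∑ i ∈ S, P.gain v α i (sel i) +
      (Td.card * (δ * A) - δ * d * (P.usage sel S j - P.usage sel Td j)) := by
    have h1 : P.usage sel S j - P.usage sel Td j =
        ∑ i ∈ S.filter (fun i => ¬ P.Tied v α i), P.choiceUse j i (sel i) := by
      rw [usage, usage, ← sum_filter_add_sum_filter_not S (fun i => P.Tied v α i)]
      ring
    rw [hβ', sum_add_distrib, sum_ite, sum_const, nsmul_eq_mul, h1, sum_neg_distrib, ← mul_sum]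
    apply le_of_eq; ring
  have hc : ∑ k, ε * P.c k * Function.update α j (α j + δ * d) k =
      ∑ k, ε * P.c k * α k + δ * d * (ε * P.c j) := by
    rw [← add_sum_erase _ _ (mem_univ j), ← add_sum_erase (a := j) univ
      (fun k => ε * P.c k * α k) (mem_univ j), Function.update_self]
    have : ∑ k ∈ univ.erase j, ε * P.c k * Function.update α j (α j + δ * d) k =
        ∑ k ∈ univ.erase j, ε * P.c k * α k :=
      sum_congr rfl fun k hk => by rw [Function.update_of_ne (ne_of_mem_erase hk)]
    rw [this]; ring
  have hTdle : P.usage sel Td j ≤ m * A := by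
    calc _ ≤ ∑ _i ∈ Td, A := sum_le_sum fun i _ => hle i _
      _ = Td.card * A := by simp
      _ ≤ _ := by gcongr
  have hTd0 : 0 ≤ P.usage sel Td j := sum_nonneg fun i _ => P.choiceUse_nonneg j i _
  simp only [sampleDualObj, hc] at hobj
  have hfin : δ * (d * (P.usage sel S j - P.usage sel Td j)) ≤
      δ * (d * (ε * P.c j) + m * A) := by
    have : δ * (Td.card * A) ≤ δ * (m * A) := by gcongr
    nlinarith
  have hfin' := le_of_mul_le_mul_left hfin hδ0
  -- This is the second `m * A` of the bound: the use by the tied agents themselves. The first one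
  -- is their allowance in `β'`.
  have : d * P.usage sel Td j ≤ m * A := by
    have : d ≤ 1 := (abs_le.1 hd).2
    nlinarith
  linarith

end PackingLP

/-! ### Blocks of arrivals and the run of the allocation. -/

/-- The last agents in the arrival order `π`, after the first `r` ones. -/
def agentsFrom {n : ℕ} (r : ℕ) (π : Equiv.Perm (Fin n)) : Finset (Fin n) :=
  univ.filter fun i => r ≤ (π.symm i : ℕ)

/-- The agents at positions `s, …, r - 1` of the arrival order `π`. -/
def agentsBetween {n : ℕ} (s r : ℕ) (π : Equiv.Perm (Fin n)) : Finset (Fin n) :=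
  univ.filter fun i => s ≤ (π.symm i : ℕ) ∧ (π.symm i : ℕ) < r

theorem firstAgents_eq_arrivals {n : ℕ} (s : ℕ) (π : Equiv.Perm (Fin n)) :
    firstAgents s π = arrivals (univ.filter fun p : Fin n => (p : ℕ) < s) π := by
  ext i; simp [firstAgents, arrivals, mem_map_equiv]

theorem agentsFrom_eq_arrivals {n : ℕ} (r : ℕ) (π : Equiv.Perm (Fin n)) :
    agentsFrom r π = arrivals (univ.filter fun p : Fin n => r ≤ (p : ℕ)) π := by
  ext i; simp [agentsFrom, arrivals, mem_map_equiv]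

theorem card_positions_lt {n s : ℕ} (hs : s ≤ n) :
    (univ.filter fun p : Fin n => (p : ℕ) < s).card = s := by
  rw [Fin.card_filter_val_lt]; omega

theorem card_positions_ge {n r : ℕ} :
    (univ.filter fun p : Fin n => r ≤ (p : ℕ)).card = n - r := by
  have h := card_filter_add_card_filter_not (s := (univ : Finset (Fin n)))
    (fun p : Fin n => (p : ℕ) < r)
  rw [Fin.card_filter_val_lt, card_univ, Fintype.card_fin] at h
  simp only [not_lt] at h
  omega

namespace PackingLP

variable {n m : ℕ} (P : PackingLP n m)

theorem usage_mono (sel : (i : Fin n) → P.Choice i) {A B : Finset (Fin n)} (h : A ⊆ B)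
    (j : Fin m) : P.usage sel A j ≤ P.usage sel B j :=
  sum_le_sum_of_subset_of_nonneg h fun _ _ _ => P.choiceUse_nonneg _ _ _

theorem value_mono (sel : (i : Fin n) → P.Choice i) {A B : Finset (Fin n)} (h : A ⊆ B) :
    P.value sel A ≤ P.value sel B :=
  sum_le_sum_of_subset_of_nonneg h fun _ _ _ => P.choiceValue_nonneg _ _

theorem value_nonneg (sel : (i : Fin n) → P.Choice i) (A : Finset (Fin n)) :
    0 ≤ P.value sel A := sum_nonneg fun _ _ => P.choiceValue_nonneg _ _

theorem usage_served_le (s : ℕ) (π : Equiv.Perm (Fin n)) (sel : (i : Fin n) → P.Choice i)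
    (t : ℕ) (j : Fin m) : P.usage sel (P.served s π sel t) j ≤ P.c j := by
  induction t with
  | zero => simpa [served, usage] using (P.c_pos j).le
  | succ t ih =>
    rw [served]
    split_ifs with h h2
    · exact h2.2 j
    · exact ih
    · exact ih

theorem served_subset_succ (s : ℕ) (π : Equiv.Perm (Fin n)) (sel : (i : Fin n) → P.Choice i)
    (t : ℕ) : P.served s π sel t ⊆ P.served s π sel (t + 1) := by
  rw [served]
  split_ifs
  · exact subset_insert _ _
  · exact Subset.rfl
  · exact Subset.rfl

theorem served_mono (s : ℕ) (π : Equiv.Perm (Fin n)) (sel : (i : Fin n) → P.Choice i) :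
    Monotone (P.served s π sel) :=
  monotone_nat_of_le_succ (P.served_subset_succ s π sel)

/-- As long as the selected options fit, nobody is skipped. -/
theorem served_eq_agentsBetween {s r : ℕ} {π : Equiv.Perm (Fin n)}
    {sel : (i : Fin n) → P.Choice i} (hr : r ≤ n)
    (h : ∀ j, P.usage sel (agentsBetween s r π) j ≤ P.c j) {t : ℕ} (ht : t ≤ r) :
    P.served s π sel t = agentsBetween s t π := by
  induction t with
  | zero => ext i; simp [served, agentsBetween]
  | succ t ih =>
    have hlt : t < n := by omega
    rw [served, dif_pos hlt, ih (by omega)]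
    by_cases hst : s ≤ t
    · have hins : insert (π ⟨t, hlt⟩) (agentsBetween s t π) = agentsBetween s (t + 1) π := by
        ext i
        have : i = π ⟨t, hlt⟩ ↔ (π.symm i : ℕ) = t := by
          rw [← Equiv.symm_apply_eq, Fin.ext_iff]
        simp only [agentsBetween, mem_insert, mem_filter, mem_univ, true_and, this]
        omega
      rw [hins, if_pos]
      refine ⟨hst, fun j => (P.usage_mono sel (fun i hi => ?_) j).trans (h j)⟩
      simp only [agentsBetween, mem_filter, mem_univ, true_and] at hi ⊢
      omega
    · rw [if_neg fun h => hst h.1]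
      ext i
      simp only [agentsBetween, mem_filter, mem_univ, true_and]
      omega

/-- The three blocks of positions cover all agents but overlap if `r < s`, whence an inequality. -/
theorem value_univ_le (sel : (i : Fin n) → P.Choice i) (s r : ℕ) (π : Equiv.Perm (Fin n)) :
    P.value sel univ ≤ P.value sel (firstAgents s π) + P.value sel (agentsFrom r π) +
      P.value sel (agentsBetween s r π) := by
  simp only [value, firstAgents, agentsFrom, agentsBetween, sum_filter, ← sum_add_distrib]
  refine sum_le_sum fun i _ => ?_
  have := P.choiceValue_nonneg i (sel i)
  split_ifs <;> first | linarith | omega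

theorem usage_between_add_usage_from_le (sel : (i : Fin n) → P.Choice i) (s r : ℕ)
    (π : Equiv.Perm (Fin n)) (j : Fin m) :
    P.usage sel (agentsBetween s r π) j + P.usage sel (agentsFrom r π) j ≤
      P.usage sel univ j := by
  simp only [usage, agentsFrom, agentsBetween, sum_filter, ← sum_add_distrib]
  refine sum_le_sum fun i _ => ?_
  have := P.choiceUse_nonneg j i (sel i)
  split_ifs <;> linarith

theorem agentsBetween_subset_compl (s r : ℕ) (π : Equiv.Perm (Fin n)) :
    agentsBetween s r π ⊆ (firstAgents s π)ᶜ := by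
  intro i
  simp only [agentsBetween, firstAgents, mem_filter, mem_univ, true_and, mem_compl]
  omega

/-! ### Bad orders, and success of the algorithm on all others. -/

/-- The sample hides that the selection `sel` uses too much of resource `j`. -/
def hiddenOveruse (ε : ℝ) (sel : (i : Fin n) → P.Choice i) (j : Fin m) :
    Set (Equiv.Perm (Fin n)) :=
  {π | (1 + 65 * ε) * P.c j < P.usage sel univ j ∧
    P.usage sel (firstAgents ⌊ε * n⌋₊ π) j ≤ ε * P.c j * (1 + 2 * ε ^ 2)}

/-- The sample hides that the selection `sel` uses too little of resource `j`. -/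
def hiddenUnderuse (ε : ℝ) (sel : (i : Fin n) → P.Choice i) (j : Fin m) :
    Set (Equiv.Perm (Fin n)) :=
  {π | P.usage sel univ j < (1 - 10 * ε) * P.c j ∧
    ε * P.c j * (1 - 2 * ε ^ 2) ≤ P.usage sel (firstAgents ⌊ε * n⌋₊ π) j}

/-- The last agents use too little of resource `j`, so that the earlier ones may exhaust it. -/
def lowFinalUse (ε : ℝ) (sel : (i : Fin n) → P.Choice i) (j : Fin m) :
    Set (Equiv.Perm (Fin n)) :=
  {π | (2500 * ε < 1 ∧ P.c j / 2 < P.usage sel univ j) ∧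
    P.usage sel (agentsFrom (n - ⌈300 * ε * n⌉₊) π) j ≤ 66 * ε * P.c j}

/-- The agents at the positions `B` have too large a part of the value. -/
def largeValue (ε : ℝ) (sel : (i : Fin n) → P.Choice i) (B : Finset (Fin n)) :
    Set (Equiv.Perm (Fin n)) :=
  {π | (2500 * ε < 1 ∧ 0 < P.OPT ∧ P.value sel univ ≤ 2 * P.OPT) ∧
    1212 * ε * P.OPT ≤ P.value sel (arrivals B π)}

/-- The arrival orders that are not representative for the selection `sel`. -/
def badOrders (ε : ℝ) (sel : (i : Fin n) → P.Choice i) : Set (Equiv.Perm (Fin n)) :=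
  (⋃ j ∈ (univ : Finset (Fin m)),
    (P.hiddenOveruse ε sel j ∪ P.hiddenUnderuse ε sel j ∪ P.lowFinalUse ε sel j)) ∪
  (P.largeValue ε sel (univ.filter fun p : Fin n => (p : ℕ) < ⌊ε * n⌋₊) ∪
    P.largeValue ε sel (univ.filter fun p : Fin n => n - ⌈300 * ε * n⌉₊ ≤ (p : ℕ)))

/-- For a representative order the algorithm succeeds. -/
theorem allocation_of_not_mem_badOrders {ε : ℝ} (hε0 : 0 < ε) (hε1 : ε < 1) {v : P.Values}
    (hgp : P.GeneralPosition v) (hv : ∀ i o, n * |v i o - P.w i o| ≤ ε * P.OPT)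
    {A : Fin m → ℝ} (hA : ∀ j, 0 ≤ A j) (haA : ∀ i o j, P.a i o j ≤ A j)
    (hmA : ∀ j, m * A j ≤ ε ^ 3 * P.c j)
    {W : ℝ} (hW : 0 ≤ W) (hwW : ∀ i o, P.w i o ≤ W) (hmW : m * W ≤ ε * P.OPT)
    {π : Equiv.Perm (Fin n)} {α : Fin m → ℝ}
    (hα : P.IsOptimalPrice v ε (firstAgents ⌊ε * n⌋₊ π) α)
    (hπ : π ∉ P.badOrders ε (P.bestOf (P.pattern v α)))
    {sel : (i : Fin n) → P.Choice i} (hsel : ∀ i, P.IsBest v α i (sel i)) :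
    (∀ j, P.usage sel (P.served ⌊ε * n⌋₊ π sel n) j ≤ P.c j) ∧
      (1 - 2500 * ε) * P.OPT ≤ P.value sel (P.served ⌊ε * n⌋₊ π sel n) ∧
      (∀ j, P.usage sel (firstAgents ⌊ε * n⌋₊ π)ᶜ j ≤ (1 + 2500 * ε) * P.c j) ∧
      (1 - 2500 * ε) * P.OPT ≤ P.value sel (firstAgents ⌊ε * n⌋₊ π)ᶜ := by
  set σ := P.bestOf (P.pattern v α) with hσdef
  have hσ : ∀ i, P.IsBest v α i (σ i) := fun i => P.isBest_bestOf v α i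
  have hα0 : ∀ j, 0 ≤ α j := by
    obtain ⟨β, hβ, -⟩ := hα
    exact hβ.1
  simp only [badOrders, Set.mem_union, Set.mem_iUnion, not_or, not_exists, mem_univ,
    exists_prop, true_and] at hπ
  obtain ⟨huse, hvalS, hvalL⟩ := hπ
  set s := ⌊ε * n⌋₊ with hs
  set r := n - ⌈300 * ε * n⌉₊ with hr
  have hε2 : ε ^ 2 < ε := by nlinarith
  have hε3 : ε ^ 3 ≤ ε ^ 2 := by nlinarith [sq_nonneg ε]
  have husele : ∀ j i x, P.choiceUse j i x ≤ A j := fun j i x =>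
    P.choiceUse_le (hA j) (fun i o => haA i o j) i x
  have hover : ∀ j, P.usage σ univ j ≤ (1 + 65 * ε) * P.c j := by
    intro j
    by_contra hlt
    refine (huse j).1.1 ⟨not_le.1 hlt, ?_⟩
    have := P.usage_untied_of_isOptimalPrice hα hσ hgp (hA j) (husele j) (d := 1) (by simp)
      (Or.inl zero_le_one)
    linarith [hmA j]
  have hunder : ∀ j, 0 < α j → (1 - 10 * ε) * P.c j ≤ P.usage σ univ j := by
    intro j hj
    by_contra hlt
    refine (huse j).1.2 ⟨not_le.1 hlt, ?_⟩
    have := P.usage_untied_of_isOptimalPrice hα hσ hgp (hA j) (husele j) (d := -1) (by simp)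
      (Or.inr hj)
    linarith [hmA j]
  -- The bad events concern the canonical selection `σ`; any other selection of best choices differs
  -- from it on at most `m` tied agents.
  have htransfer : ∀ B j, P.usage sel B j ≤ P.usage σ B j + ε ^ 3 * P.c j := fun B j =>
    (P.sum_le_sum_add_of_isBest hgp hα0 hsel hσ (P.choiceUse j) (hA j)
      (P.choiceUse_nonneg j) (husele j) B).trans (by
        have := hmA j
        simp only [usage]; linarith)
  have hvtransfer : ∀ B, P.value σ B ≤ P.value sel B + ε * P.OPT := fun B =>
    (P.sum_le_sum_add_of_isBest hgp hα0 hσ hsel P.choiceValue hW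
      P.choiceValue_nonneg (P.choiceValue_le hW hwW) B).trans (by
        simp only [value]; linarith)
  have hvalue : (1 - 2500 * ε) * P.OPT ≤ P.value sel (P.served s π sel n) ∧
      (1 - 2500 * ε) * P.OPT ≤ P.value sel (firstAgents s π)ᶜ := by
    -- Otherwise the claimed lower bound on the value is at most zero.
    by_cases hsmall : 2500 * ε < 1 ∧ 0 < P.OPT
    swap
    · have hneg : (1 - 2500 * ε) * P.OPT ≤ 0 := by
        rcases not_and_or.1 hsmall with h | h
        · exact mul_nonpos_of_nonpos_of_nonneg (by linarith) P.OPT_nonneg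
        · rw [le_antisymm (not_lt.1 h) P.OPT_nonneg, mul_zero]
      exact ⟨hneg.trans (P.value_nonneg _ _), hneg.trans (P.value_nonneg _ _)⟩
    obtain ⟨hεs, hOPT⟩ := hsmall
    have hn : (0 : ℝ) < n := by
      rcases Nat.eq_zero_or_pos n with h | h
      · subst h
        have := P.OPT_le_card_mul hW hwW
        simp at this; linarith
      · exact_mod_cast h
    set δ := ε * P.OPT / n with hδdef
    have hδ : 0 ≤ δ := by positivity
    have hnδ : n * δ = ε * P.OPT := by rw [hδdef]; field_simp
    have hvδ : ∀ i o, |v i o - P.w i o| ≤ δ := fun i o => by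
      rw [hδdef, le_div_iff₀ hn, mul_comm]; exact hv i o
    have hσ2 : P.value σ univ ≤ 2 * P.OPT := P.value_le_two_mul_OPT σ fun j =>
      (hover j).trans (by have := P.c_pos j; nlinarith)
    have hdual := P.OPT_le_dual hα0 hδ hvδ hσ
    have hsplit := P.sum_workValue_eq v α σ
    have habs := abs_le.1 (P.abs_workValue_sub_le hδ hvδ σ)
    have hg0 : 0 ≤ ∑ i, P.gain v α i (σ i) :=
      sum_nonneg fun i _ => P.gain_nonneg_of_isBest (hσ i)
    have hpay : (1 - 10 * ε) * ∑ j, α j * P.c j ≤ ∑ j, α j * P.usage σ univ j := by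
      rw [mul_sum]
      refine sum_le_sum fun j _ => ?_
      rcases (hα0 j).eq_or_lt with h | h
      · simp [← h]
      · nlinarith [hunder j h]
    have hpay0 : 0 ≤ ∑ j, α j * P.c j :=
      sum_nonneg fun j _ => mul_nonneg (hα0 j) (P.c_pos j).le
    have hεO : ε * P.OPT ≤ P.OPT := by nlinarith
    -- The payments are at most the working value, hence at most `3 * OPT`, and `1 - 10 * ε ≥ 1 /
    -- 2`.
    have hpay6 : ∑ j, α j * P.c j ≤ 6 * P.OPT := by nlinarith
    -- The loss of 62 is `10 * 6` from slackness, 1 from weak duality and 1 from passing between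
    -- working and true values.
    have hvalσ : (1 - 62 * ε) * P.OPT ≤ P.value σ univ := by
      have : ε * ∑ j, α j * P.c j ≤ ε * (6 * P.OPT) := by gcongr
      linarith
    have hS : P.value σ (firstAgents s π) < 1212 * ε * P.OPT := by
      by_contra hle
      exact hvalS ⟨⟨hεs, hOPT, hσ2⟩, by rw [← firstAgents_eq_arrivals]; exact not_lt.1 hle⟩
    have hL : P.value σ (agentsFrom r π) < 1212 * ε * P.OPT := by
      by_contra hle
      exact hvalL ⟨⟨hεs, hOPT, hσ2⟩, by rw [← agentsFrom_eq_arrivals]; exact not_lt.1 hle⟩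
    -- The losses add up to `62 + 1212 + 1212 + 1 = 2487`.
    have hmid : (1 - 2500 * ε) * P.OPT ≤ P.value sel (agentsBetween s r π) := by
      have h1 := P.value_univ_le σ s r π
      have h2 := hvtransfer (agentsBetween s r π)
      have : 0 ≤ ε * P.OPT := by positivity
      linarith
    -- If more than half of `c j` is used, the balance is `65 - 66 + 1 = 0` in units of `ε * c j`:
    -- overuse, less the use by the last agents, plus ties. Otherwise there is ample room.
    have hfit : ∀ j, P.usage sel (agentsBetween s r π) j ≤ P.c j := by
      intro j
      have hc := P.c_pos j
      have h1 := htransfer (agentsBetween s r π) j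
      have h2 := P.usage_between_add_usage_from_le σ s r π j
      have h3 : ε ^ 3 * P.c j ≤ ε * P.c j := by gcongr; linarith
      have h4 : 2500 * ε * P.c j ≤ 1 * P.c j := by gcongr
      by_cases hhalf : P.c j / 2 < P.usage σ univ j
      · have h5 : 66 * ε * P.c j < P.usage σ (agentsFrom r π) j := by
          by_contra hle
          exact (huse j).2 ⟨⟨hεs, hhalf⟩, not_lt.1 hle⟩
        have h6 := hover j
        linarith
      · have h5 : 0 ≤ P.usage σ (agentsFrom r π) j :=
          sum_nonneg fun i _ => P.choiceUse_nonneg j i _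
        linarith
    have hserved : agentsBetween s r π ⊆ P.served s π sel n := by
      rw [← P.served_eq_agentsBetween (Nat.sub_le _ _) hfit le_rfl]
      exact P.served_mono s π sel (Nat.sub_le _ _)
    exact ⟨hmid.trans (P.value_mono sel hserved),
      hmid.trans (P.value_mono sel (agentsBetween_subset_compl s r π))⟩
  refine ⟨fun j => P.usage_served_le s π sel n j, hvalue.1, fun j => ?_, hvalue.2⟩
  have h1 := P.usage_mono sel (subset_univ (firstAgents s π)ᶜ) j
  have h2 := htransfer univ j
  have h3 := hover j
  have hc := P.c_pos j
  have h4 : ε ^ 3 * P.c j ≤ ε * P.c j := by gcongr; linarith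
  have : 0 < ε * P.c j := by positivity
  linarith

end PackingLP

/-! ### Probability of bad orders for a fixed selection. -/

theorem orderProb_empty {n : ℕ} : orderProb n ∅ = 0 := by simp [orderProb]

/-- The bad events carry a clause that does not depend on the order: either it fails and the event
is empty, or it is available in the tail bound. -/
theorem orderProb_le_of_and {n : ℕ} {p : Prop} {E : Set (Equiv.Perm (Fin n))} {r : ℝ}
    (hr : 0 ≤ r) (h : p → orderProb n E ≤ r) : orderProb n {π | p ∧ π ∈ E} ≤ r := by
  by_cases hp : p
  · simpa [hp] using h hp
  · simpa [hp, orderProb] using hr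

/-- Lower-tail Chernoff bound. -/
theorem orderProb_sum_arrivals_le {n : ℕ} (hn : 0 < n) (B : Finset (Fin n)) {x : Fin n → ℝ}
    (h0 : ∀ i, 0 ≤ x i) {A : ℝ} (hA : 0 < A) (h1 : ∀ i, x i ≤ A) {l t k : ℝ} (hl : 0 < l)
    (h : l * t + k * A ≤ (1 - Real.exp (-l)) * (B.card / n * ∑ i, x i)) :
    orderProb n {π | ∑ i ∈ arrivals B π, x i ≤ t} ≤ (n + 1) * Real.exp (-k) := by
  refine (orderProb_mono fun π hπ => ?_).trans
    ((orderProb_arrivals_le hn B x h0 hA h1 (-l) t).trans ?_)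
  · have : ∑ i ∈ arrivals B π, x i ≤ t := hπ
    change -l * t ≤ -l * _
    nlinarith
  · gcongr
    rw [div_le_iff₀ hA]
    linarith

/-- Upper-tail Chernoff bound. -/
theorem orderProb_le_sum_arrivals {n : ℕ} (hn : 0 < n) (B : Finset (Fin n)) {x : Fin n → ℝ}
    (h0 : ∀ i, 0 ≤ x i) {A : ℝ} (hA : 0 < A) (h1 : ∀ i, x i ≤ A) {l t k : ℝ} (hl : 0 < l)
    (h : (Real.exp l - 1) * (B.card / n * ∑ i, x i) + k * A ≤ l * t) :
    orderProb n {π | t ≤ ∑ i ∈ arrivals B π, x i} ≤ (n + 1) * Real.exp (-k) := by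
  refine (orderProb_mono fun π hπ => ?_).trans
    ((orderProb_arrivals_le hn B x h0 hA h1 l t).trans ?_)
  · have : t ≤ ∑ i ∈ arrivals B π, x i := hπ
    change l * t ≤ l * _
    nlinarith
  · gcongr
    rw [div_le_iff₀ hA]
    linarith

/-- Rounding loses less than one agent, a fraction of at most `ε ^ 2` of `ε * n`. For `ε ≤ 1 / 2`
this is absorbed since `(1 - ε ^ 2) (1 + 2 ε) ≥ 1`; for larger `ε`, rounding down a number that is
at least 1 loses less than half, and `1 + 2 ε ≥ 2`. -/
theorem le_floor_div_mul {n : ℕ} {ε : ℝ} (hε0 : 0 < ε) (hε1 : ε < 1) (hn : 1 ≤ ε ^ 3 * n) :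
    ε ≤ (⌊ε * n⌋₊ : ℝ) / n * (1 + 2 * ε) := by
  have hn0 : (0 : ℝ) < n := by
    rcases (Nat.cast_nonneg n : (0 : ℝ) ≤ n).eq_or_lt with h | h
    · rw [← h] at hn; linarith
    · exact h
  have hεn : 1 ≤ ε * n := by
    have h3 : ε ^ 3 ≤ ε := by nlinarith [sq_nonneg ε, mul_pos hε0 hε0]
    have : ε ^ 3 * n ≤ ε * n := by gcongr
    linarith
  have hfl := Nat.lt_floor_add_one (ε * n)
  rw [div_mul_eq_mul_div, le_div_iff₀ hn0]
  rcases le_total ε (1 / 2) with h | h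
  · have h2 : ε * n * (1 - ε ^ 2) ≤ ⌊ε * n⌋₊ := by nlinarith
    have h3 : 1 ≤ (1 - ε ^ 2) * (1 + 2 * ε) := by nlinarith [mul_pos hε0 hε0]
    calc ε * n = ε * n * 1 := (mul_one _).symm
      _ ≤ ε * n * ((1 - ε ^ 2) * (1 + 2 * ε)) := by gcongr
      _ = ε * n * (1 - ε ^ 2) * (1 + 2 * ε) := by ring
      _ ≤ _ := by gcongr
  · have h1 : (1 : ℝ) ≤ ⌊ε * n⌋₊ := by
      exact_mod_cast (Nat.one_le_floor_iff _).2 hεn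
    nlinarith

namespace PackingLP

variable {n m : ℕ} (P : PackingLP n m)

theorem orderProb_hiddenOveruse_le {ε k : ℝ} (hε0 : 0 < ε) (hε1 : ε < 1) (hk : 1 ≤ k)
    {j : Fin m} (ha : ∀ i o, P.a i o j * k ≤ ε ^ 3 * P.c j) (sel : (i : Fin n) → P.Choice i) :
    orderProb n (P.hiddenOveruse ε sel j) ≤ (n + 1) * Real.exp (-(8 * k)) := by
  refine orderProb_le_of_and (by positivity) fun hover => ?_
  have hc := P.c_pos j
  have hk0 : 0 < k := by linarith
  set A := ε ^ 3 * P.c j / k with hA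
  have hA0 : 0 < A := by positivity
  have hkA : k * A = ε ^ 3 * P.c j := by rw [hA]; field_simp
  have hle : ∀ i x, P.choiceUse j i x ≤ A :=
    P.choiceUse_le hA0.le fun i o => by rw [hA, le_div_iff₀ hk0]; exact ha i o
  have hUn : P.usage sel univ j ≤ n * A := by
    calc _ ≤ ∑ _i : Fin n, A := sum_le_sum fun i _ => hle i _
      _ = _ := by simp
  -- Overuse by demands of at most `A` each forces many agents, so rounding `ε * n` is harmless.
  have hcn : 1 ≤ ε ^ 3 * n := by
    have h1 : P.c j ≤ n * A := by nlinarith [mul_pos hε0 hc]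
    have h2 : k * P.c j ≤ n * (ε ^ 3 * P.c j) := by
      rw [← hkA]; nlinarith
    have h3 : P.c j * 1 ≤ P.c j * (ε ^ 3 * n) := by nlinarith
    exact le_of_mul_le_mul_left h3 hc
  have hn : 0 < n := by
    rcases Nat.eq_zero_or_pos n with h | h
    · rw [h] at hcn; norm_num at hcn
    · exact h
  have hsn : ⌊ε * n⌋₊ ≤ n := by
    refine Nat.floor_le_of_le ?_
    nlinarith [(Nat.cast_nonneg n : (0 : ℝ) ≤ n)]
  have hfl := le_floor_div_mul hε0 hε1 hcn
  have hrw : {π : Equiv.Perm (Fin n) | P.usage sel (firstAgents ⌊ε * n⌋₊ π) j ≤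
      ε * P.c j * (1 + 2 * ε ^ 2)} = {π | ∑ i ∈ arrivals
        (univ.filter fun p : Fin n => (p : ℕ) < ⌊ε * n⌋₊) π, P.choiceUse j i (sel i) ≤
      ε * P.c j * (1 + 2 * ε ^ 2)} := by
    ext π; rw [Set.mem_ofPred_eq, Set.mem_ofPred_eq, firstAgents_eq_arrivals]; rfl
  change orderProb n {π : Equiv.Perm (Fin n) | P.usage sel (firstAgents ⌊ε * n⌋₊ π) j ≤
      ε * P.c j * (1 + 2 * ε ^ 2)} ≤ _
  rw [hrw]
  refine orderProb_sum_arrivals_le hn _ (fun i => P.choiceUse_nonneg j i _) hA0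
    (fun i => hle i _) hε0 ?_
  rw [card_positions_lt hsn]
  set ρ : ℝ := (⌊ε * n⌋₊ : ℝ) / n with hρ
  have hρ0 : 0 ≤ ρ := by positivity
  change _ ≤ (1 - Real.exp (-ε)) * (ρ * P.usage sel univ j)
  have hexp : ε / (1 + ε) ≤ 1 - Real.exp (-ε) := by
    have h1 := Real.add_one_le_exp ε
    have h2 : Real.exp (-ε) ≤ 1 / (1 + ε) := by
      rw [Real.exp_neg, ← one_div]
      exact one_div_le_one_div_of_le (by linarith) (by linarith)
    have h3 : ε / (1 + ε) = 1 - 1 / (1 + ε) := by field_simp; ring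
    linarith
  have hμ : ε * ((1 + 65 * ε) * P.c j) ≤ ρ * P.usage sel univ j * (1 + 2 * ε) := by
    have h1 : ε * ((1 + 65 * ε) * P.c j) ≤ ρ * (1 + 2 * ε) * ((1 + 65 * ε) * P.c j) := by
      gcongr
    have h2 : ρ * (1 + 2 * ε) * ((1 + 65 * ε) * P.c j) ≤
        ρ * (1 + 2 * ε) * P.usage sel univ j := by gcongr
    linarith
  -- The constant 65 comes from here, with equality at `ε = 1`. The factors account for rounding,
  -- for `1 - exp (-ε) ≥ ε / (1 + ε)`, and for the threshold with the term `8 * k * A`.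
  have hpoly : (1 + 2 * ε) * ((1 + ε) * (1 + 8 * ε + 2 * ε ^ 2)) ≤ 1 + 65 * ε := by
    have h2 : ε ^ 2 ≤ ε := by nlinarith
    have h3 : ε ^ 3 ≤ ε := by nlinarith [sq_nonneg ε]
    have h4 : ε ^ 4 ≤ ε := by nlinarith [pow_pos hε0 3]
    nlinarith
  have hμ2 : (1 + ε) * (ε * P.c j * (1 + 8 * ε + 2 * ε ^ 2)) ≤ ρ * P.usage sel univ j := by
    have h1 : (1 + 2 * ε) * ((1 + ε) * (ε * P.c j * (1 + 8 * ε + 2 * ε ^ 2))) ≤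
        (1 + 2 * ε) * (ρ * P.usage sel univ j) := by
      have : ε * P.c j * ((1 + 2 * ε) * ((1 + ε) * (1 + 8 * ε + 2 * ε ^ 2))) ≤
          ε * P.c j * (1 + 65 * ε) := by gcongr
      linarith
    exact le_of_mul_le_mul_left h1 (by linarith)
  calc _ = ε / (1 + ε) * ((1 + ε) * (ε * P.c j * (1 + 8 * ε + 2 * ε ^ 2))) := by
        rw [mul_assoc 8, hkA]; field_simp; ring
    _ ≤ ε / (1 + ε) * (ρ * P.usage sel univ j) := by gcongr
    _ ≤ _ := by
        refine mul_le_mul_of_nonneg_right hexp (mul_nonneg hρ0 ?_)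
        exact sum_nonneg fun i _ => P.choiceUse_nonneg j i _

theorem orderProb_hiddenUnderuse_le {ε k : ℝ} (hn : 0 < n) (hε0 : 0 < ε) (hε1 : ε < 1)
    (hk : 1 ≤ k) {j : Fin m} (ha : ∀ i o, P.a i o j * k ≤ ε ^ 3 * P.c j)
    (sel : (i : Fin n) → P.Choice i) :
    orderProb n (P.hiddenUnderuse ε sel j) ≤ (n + 1) * Real.exp (-(8 * k)) := by
  refine orderProb_le_of_and (by positivity) fun hunder => ?_
  have hc := P.c_pos j
  have hk0 : 0 < k := by linarith
  set A := ε ^ 3 * P.c j / k with hA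
  have hA0 : 0 < A := by positivity
  have hkA : k * A = ε ^ 3 * P.c j := by rw [hA]; field_simp
  have hle : ∀ i x, P.choiceUse j i x ≤ A :=
    P.choiceUse_le hA0.le fun i o => by rw [hA, le_div_iff₀ hk0]; exact ha i o
  have hsn : ⌊ε * n⌋₊ ≤ n := by
    refine Nat.floor_le_of_le ?_
    nlinarith [(Nat.cast_nonneg n : (0 : ℝ) ≤ n)]
  have hrw : {π : Equiv.Perm (Fin n) | ε * P.c j * (1 - 2 * ε ^ 2) ≤
      P.usage sel (firstAgents ⌊ε * n⌋₊ π) j} = {π | ε * P.c j * (1 - 2 * ε ^ 2) ≤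
      ∑ i ∈ arrivals (univ.filter fun p : Fin n => (p : ℕ) < ⌊ε * n⌋₊) π,
        P.choiceUse j i (sel i)} := by
    ext π; rw [Set.mem_ofPred_eq, Set.mem_ofPred_eq, firstAgents_eq_arrivals]; rfl
  change orderProb n {π : Equiv.Perm (Fin n) | ε * P.c j * (1 - 2 * ε ^ 2) ≤
      P.usage sel (firstAgents ⌊ε * n⌋₊ π) j} ≤ _
  rw [hrw]
  refine orderProb_le_sum_arrivals hn _ (fun i => P.choiceUse_nonneg j i _) hA0
    (fun i => hle i _) hε0 ?_
  rw [card_positions_lt hsn]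
  change (Real.exp ε - 1) * (_ * P.usage sel univ j) + _ ≤ _
  have hU0 : 0 ≤ P.usage sel univ j := sum_nonneg fun i _ => P.choiceUse_nonneg j i _
  have hρ : (⌊ε * n⌋₊ : ℝ) / n ≤ ε := by
    rw [div_le_iff₀ (by exact_mod_cast hn)]
    exact Nat.floor_le (by positivity)
  have hexp : Real.exp ε - 1 ≤ ε + ε ^ 2 := by
    have := (abs_le.1 (Real.abs_exp_sub_one_sub_id_le (abs_le.2 ⟨by linarith, hε1.le⟩))).2
    linarith
  have hexp0 : 0 ≤ Real.exp ε - 1 := by linarith [Real.add_one_le_exp ε]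
  have hμ : (⌊ε * n⌋₊ : ℝ) / n * P.usage sel univ j ≤ ε * ((1 - 10 * ε) * P.c j) := by gcongr
  -- It bounds a nonnegative mean, so `10 * ε ≤ 1` need not be assumed.
  have hμ0 : 0 ≤ ε * ((1 - 10 * ε) * P.c j) := le_trans (by positivity) hμ
  -- After division by `ε ^ 2 * c j` the claim is `(1 + ε) (1 - 10 ε) + 8 ε ≤ 1 - 2 ε ^ 2`.
  calc _ ≤ (ε + ε ^ 2) * (ε * ((1 - 10 * ε) * P.c j)) + 8 * k * A := by gcongr
    _ ≤ _ := by
      rw [mul_assoc 8, hkA]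
      have : 0 < ε ^ 3 * P.c j := by positivity
      have : 0 < ε ^ 4 * P.c j := by positivity
      nlinarith

theorem ceil_le_of_small {n : ℕ} {ε : ℝ} (hε : 2500 * ε < 1) : ⌈300 * ε * n⌉₊ ≤ n := by
  refine Nat.ceil_le.2 ?_
  nlinarith [(Nat.cast_nonneg n : (0 : ℝ) ≤ n)]

theorem orderProb_lowFinalUse_le {ε k : ℝ} (hn : 0 < n) (hε0 : 0 < ε)
    (hk : 1 ≤ k) {j : Fin m} (ha : ∀ i o, P.a i o j * k ≤ ε ^ 3 * P.c j)
    (sel : (i : Fin n) → P.Choice i) :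
    orderProb n (P.lowFinalUse ε sel j) ≤ (n + 1) * Real.exp (-(8 * k)) := by
  refine orderProb_le_of_and (by positivity) fun ⟨hεs, hhalf⟩ => ?_
  have hc := P.c_pos j
  have hk0 : 0 < k := by linarith
  set A := ε ^ 3 * P.c j / k with hA
  have hA0 : 0 < A := by positivity
  have hkA : k * A = ε ^ 3 * P.c j := by rw [hA]; field_simp
  have hle : ∀ i x, P.choiceUse j i x ≤ A :=
    P.choiceUse_le hA0.le fun i o => by rw [hA, le_div_iff₀ hk0]; exact ha i o
  have hcl : ⌈300 * ε * n⌉₊ ≤ n := ceil_le_of_small hεs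
  have hrw : {π : Equiv.Perm (Fin n) | P.usage sel (agentsFrom (n - ⌈300 * ε * n⌉₊) π) j ≤
      66 * ε * P.c j} = {π | ∑ i ∈ arrivals
        (univ.filter fun p : Fin n => n - ⌈300 * ε * n⌉₊ ≤ (p : ℕ)) π,
        P.choiceUse j i (sel i) ≤ 66 * ε * P.c j} := by
    ext π; rw [Set.mem_ofPred_eq, Set.mem_ofPred_eq, agentsFrom_eq_arrivals]; rfl
  change orderProb n {π : Equiv.Perm (Fin n) | P.usage sel (agentsFrom _ π) j ≤
      66 * ε * P.c j} ≤ _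
  rw [hrw]
  refine orderProb_sum_arrivals_le hn _ (fun i => P.choiceUse_nonneg j i _) hA0
    (fun i => hle i _) one_pos ?_
  rw [card_positions_ge, Nat.sub_sub_self hcl]
  change _ ≤ (1 - Real.exp (-1)) * (_ * P.usage sel univ j)
  have hρ : 300 * ε ≤ (⌈300 * ε * n⌉₊ : ℝ) / n := by
    rw [le_div_iff₀ (by exact_mod_cast hn)]
    exact Nat.le_ceil _
  have hexp : (1 : ℝ) / 2 ≤ 1 - Real.exp (-1) := by
    have := Real.exp_neg_one_lt_d9
    norm_num at this ⊢
    linarith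
  have hε3 : ε ^ 3 * P.c j ≤ ε * P.c j := by
    gcongr
    nlinarith [mul_pos hε0 hε0]
  -- In units of `ε * c j`: `66 + 8 ≤ 75`.
  calc _ ≤ 1 / 2 * (300 * ε * (P.c j / 2)) := by
        rw [mul_assoc 8, hkA]
        have : 0 < ε * P.c j := by positivity
        linarith
    _ ≤ _ := by gcongr

theorem orderProb_largeValue_le {ε k : ℝ} (hn : 0 < n) (hε0 : 0 < ε)
    (hk : 1 ≤ k) (hw : ∀ i o, P.w i o * k ≤ ε * P.OPT) (sel : (i : Fin n) → P.Choice i)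
    {B : Finset (Fin n)} (hB : 2500 * ε < 1 → (B.card : ℝ) ≤ 300 * ε * n + 1) :
    orderProb n (P.largeValue ε sel B) ≤ (n + 1) * Real.exp (-(8 * k)) := by
  refine orderProb_le_of_and (by positivity) fun ⟨hεs, hOPT, hval⟩ => ?_
  have hk0 : 0 < k := by linarith
  have hn0 : (0 : ℝ) < n := by exact_mod_cast hn
  set A := ε * P.OPT / k with hA
  have hA0 : 0 < A := by positivity
  have hkA : k * A = ε * P.OPT := by rw [hA]; field_simp
  have hwA : ∀ i o, P.w i o ≤ A := fun i o => by rw [hA, le_div_iff₀ hk0]; exact hw i o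
  have hle : ∀ i x, P.choiceValue i x ≤ A := P.choiceValue_le hA0.le hwA
  -- Small values and a positive optimum force many agents; this absorbs the `+ 1` from rounding up.
  have hεn : 1 ≤ ε * n := by
    have h1 := P.OPT_le_card_mul hA0.le hwA
    have h2 : k * P.OPT ≤ n * (ε * P.OPT) := by rw [← hkA]; nlinarith
    have h3 : P.OPT * 1 ≤ P.OPT * (ε * n) := by nlinarith
    exact le_of_mul_le_mul_left h3 hOPT
  have hρ : (B.card : ℝ) / n ≤ 301 * ε := by
    rw [div_le_iff₀ hn0]; linarith [hB hεs]
  refine orderProb_le_sum_arrivals hn B (fun i => P.choiceValue_nonneg i _) hA0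
    (fun i => hle i _) one_pos ?_
  change (Real.exp 1 - 1) * (_ * P.value sel univ) + _ ≤ _
  have hexp : Real.exp 1 - 1 ≤ 2 := by linarith [Real.exp_one_lt_d9]
  have hv0 := P.value_nonneg sel univ
  calc _ ≤ 2 * (301 * ε * (2 * P.OPT)) + 8 * k * A := by gcongr
    _ = _ := by rw [mul_assoc 8, hkA]; ring

theorem orderProb_badOrders_le {ε k : ℝ} (hn : 0 < n) (hε0 : 0 < ε) (hε1 : ε < 1)
    (hk : 1 ≤ k) (hw : ∀ i o, P.w i o * k ≤ ε * P.OPT)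
    (ha : ∀ i o j, P.a i o j * k ≤ ε ^ 3 * P.c j) (sel : (i : Fin n) → P.Choice i) :
    orderProb n (P.badOrders ε sel) ≤ (3 * m + 2) * ((n + 1) * Real.exp (-(8 * k))) := by
  set r := ((n : ℝ) + 1) * Real.exp (-(8 * k)) with hr
  have h1 : orderProb n (⋃ j ∈ (univ : Finset (Fin m)), (P.hiddenOveruse ε sel j ∪
      P.hiddenUnderuse ε sel j ∪ P.lowFinalUse ε sel j)) ≤ m * (3 * r) := by
    refine (orderProb_biUnion_le _ _).trans ?_
    calc _ ≤ ∑ _j : Fin m, 3 * r := by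
          refine sum_le_sum fun j _ => ?_
          have e1 := P.orderProb_hiddenOveruse_le hε0 hε1 hk (fun i o => ha i o j) sel
          have e2 := P.orderProb_hiddenUnderuse_le hn hε0 hε1 hk (fun i o => ha i o j) sel
          have e3 := P.orderProb_lowFinalUse_le hn hε0 hk (fun i o => ha i o j) sel
          have e4 := orderProb_union_le (P.hiddenOveruse ε sel j ∪ P.hiddenUnderuse ε sel j)
            (P.lowFinalUse ε sel j)
          have e5 := orderProb_union_le (P.hiddenOveruse ε sel j) (P.hiddenUnderuse ε sel j)
          linarith
      _ = _ := by simp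
  have h2 := P.orderProb_largeValue_le hn hε0 hk hw sel
    (B := univ.filter fun p : Fin n => (p : ℕ) < ⌊ε * n⌋₊) (fun hεs => by
      have hp : (0 : ℝ) ≤ ε * n := by positivity
      rw [card_positions_lt (Nat.floor_le_of_le (by nlinarith [(Nat.cast_nonneg n : (0 : ℝ) ≤ n)]))]
      linarith [Nat.floor_le hp])
  have h3 := P.orderProb_largeValue_le hn hε0 hk hw sel
    (B := univ.filter fun p : Fin n => n - ⌈300 * ε * n⌉₊ ≤ (p : ℕ)) (fun hεs => by
      rw [card_positions_ge, Nat.sub_sub_self (ceil_le_of_small hεs)]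
      exact (Nat.ceil_lt_add_one (by positivity)).le)
  refine (orderProb_union_le _ _).trans ?_
  have h4 := orderProb_union_le
    (P.largeValue ε sel (univ.filter fun p : Fin n => (p : ℕ) < ⌊ε * n⌋₊))
    (P.largeValue ε sel (univ.filter fun p : Fin n => n - ⌈300 * ε * n⌉₊ ≤ (p : ℕ)))
  linarith

end PackingLP

/-! ### Union bound over patterns, and the theorem. -/

/-- The number of patterns and resources is outweighed by the probability of a bad order. -/
theorem patterns_mul_bad_le {n q m : ℕ} (h : 3 ≤ n * q) :
    ((n * (q + 1) ^ 2 + 1) ^ (m + 1) : ℕ) *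
      ((3 * m + 2) * (((n : ℝ) + 1) *
        Real.exp (-(8 * ((m + 1) * (Real.log n + Real.log q)))))) ≤ 2 / ((n : ℝ) * q) := by
  have hn : 0 < n := Nat.pos_of_ne_zero fun h0 => by simp [h0] at h
  have hq : 0 < q := Nat.pos_of_ne_zero fun h0 => by simp [h0] at h
  set N := n * q with hN
  have hNR : (n : ℝ) * q = (N : ℝ) := by rw [hN]; push_cast; rfl
  have hN0 : (0 : ℝ) < N := by exact_mod_cast (by omega : 0 < N)
  have hexp : Real.exp (-(8 * ((m + 1) * (Real.log n + Real.log q)))) =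
      ((N : ℝ) ^ (8 * (m + 1)))⁻¹ := by
    rw [← Real.log_mul (by positivity) (by positivity), hNR, Real.exp_neg,
      ← Real.exp_log (x := (N : ℝ) ^ (8 * (m + 1))) (by positivity), Real.log_pow]
    push_cast; congr 2; ring
  have h1 : n * (q + 1) ^ 2 + 1 ≤ N ^ 4 := by
    have e1 : n * (q + 1) ^ 2 ≤ 4 * N ^ 2 := by
      calc n * (q + 1) ^ 2 ≤ n * (q + q) ^ 2 := by gcongr; omega
        _ = 4 * (n * q * (1 * q)) := by ring
        _ ≤ 4 * (n * q * (n * q)) := by gcongr; exact hn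
        _ = 4 * N ^ 2 := by rw [hN]; ring
    have e2 : 9 ≤ N ^ 2 := by nlinarith
    nlinarith
  have h2 : 3 * m + 2 ≤ N ^ (m + 1) := by
    have e1 : ∀ d : ℕ, 3 * d + 2 ≤ 3 ^ (d + 1) := by
      intro d
      induction d with
      | zero => norm_num
      | succ d ih => rw [pow_succ]; omega
    exact (e1 m).trans (Nat.pow_le_pow_left h _)
  have h3 : n + 1 ≤ N ^ 2 := by
    have : n ≤ N := Nat.le_mul_of_pos_right n hq
    nlinarith
  -- The exponents are `4 (m + 1)` for the patterns, `m + 1` for the `3 m + 2` events, 2 for the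
  -- factor `n + 1` and 1 for the target `1 / N`. Their sum is at most `8 (m + 1)`, which explains
  -- the 8 in the tail bounds.
  have h4 : (n * (q + 1) ^ 2 + 1) ^ (m + 1) * ((3 * m + 2) * (n + 1)) * N ≤ N ^ (8 * (m + 1)) := by
    calc _ ≤ (N ^ 4) ^ (m + 1) * (N ^ (m + 1) * N ^ 2) * N := by gcongr
      _ = N ^ (5 * (m + 1) + 3) := by ring
      _ ≤ _ := Nat.pow_le_pow_right (by omega) (by omega)
  rw [hexp, hNR, le_div_iff₀ hN0]
  have h5 : (((n * (q + 1) ^ 2 + 1) ^ (m + 1) * ((3 * m + 2) * (n + 1)) * N : ℕ) : ℝ) ≤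
      (N : ℝ) ^ (8 * (m + 1)) := by exact_mod_cast h4
  have h6 : (((n * (q + 1) ^ 2 + 1) ^ (m + 1) * ((3 * m + 2) * (n + 1)) * N : ℕ) : ℝ) *
      ((N : ℝ) ^ (8 * (m + 1)))⁻¹ ≤ 1 := by
    rw [← div_eq_mul_inv]; exact (div_le_one (by positivity)).2 h5
  push_cast at h6 ⊢
  linarith

theorem theorem5 :
    ∃ C : ℝ, 0 < C ∧
      ∀ (n m : ℕ) (P : PackingLP n m) (ε : ℝ), 0 < ε → ε < 1 →
        (∀ i o, P.w i o * ((m + 1) * (Real.log n + Real.log P.q)) ≤ ε * P.OPT) →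
        (∀ i o j, P.a i o j * ((m + 1) * (Real.log n + Real.log P.q)) ≤ ε ^ 3 * P.c j) →
        ∀ v : P.Values, P.GeneralPosition v → (∀ i o, n * |v i o - P.w i o| ≤ ε * P.OPT) →
          1 - 2 / ((n : ℝ) * P.q) ≤
            orderProb n {π | ∀ α, P.IsOptimalPrice v ε (firstAgents ⌊ε * n⌋₊ π) α →
              ∀ sel, (∀ i, P.IsBest v α i (sel i)) →
                (∀ j, P.usage sel (P.served ⌊ε * n⌋₊ π sel n) j ≤ P.c j) ∧
                (1 - C * ε) * P.OPT ≤ P.value sel (P.served ⌊ε * n⌋₊ π sel n) ∧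
                (∀ j, P.usage sel (firstAgents ⌊ε * n⌋₊ π)ᶜ j ≤ (1 + C * ε) * P.c j) ∧
                (1 - C * ε) * P.OPT ≤ P.value sel (firstAgents ⌊ε * n⌋₊ π)ᶜ} := by
  refine ⟨2500, by norm_num, fun n m P ε hε0 hε1 hw ha v hgp hv => ?_⟩
  -- For `q = 0` division by zero turns the claimed probability into 1, so every order has to
  -- succeed; without options `OPT` and all uses vanish.
  rcases Nat.eq_zero_or_pos P.q with hq | hq
  · have hempty : ∀ i, IsEmpty (Fin (P.numOpt i)) := fun i => by
      have := P.numOpt_le_q i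
      rw [hq, Nat.le_zero] at this
      rw [this]; infer_instance
    have hnone : ∀ (i : Fin n) (x : P.Choice i), x = none := fun i x => by
      rcases x with _ | o
      · rfl
      · exact (hempty i).elim o
    have hOPT : P.OPT = 0 := le_antisymm (P.OPT_le fun x _ => by
      refine (sum_eq_zero fun i _ => ?_).le
      have := hempty i
      simp) P.OPT_nonneg
    have huse : ∀ sel A j, P.usage sel A j = 0 := fun sel A j =>
      sum_eq_zero fun i _ => by rw [hnone i (sel i)]; rfl
    have hall : ∀ E : Set (Equiv.Perm (Fin n)), (∀ π, π ∈ E) → 1 ≤ orderProb n E := by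
      intro E hE
      have := orderProb_compl E
      rw [Set.compl_empty_iff.2 (Set.eq_univ_of_forall hE), orderProb_empty] at this
      linarith
    refine le_trans ?_ (hall _ fun π α _ sel _ => ⟨fun j => ?_, ?_, fun j => ?_, ?_⟩)
    · simp [hq]
    · rw [huse]; exact (P.c_pos j).le
    · rw [hOPT, mul_zero]; exact P.value_nonneg _ _
    · rw [huse]; have := P.c_pos j; positivity
    · rw [hOPT, mul_zero]; exact P.value_nonneg _ _
  have hn : 0 < n := by
    rcases Nat.eq_zero_or_pos n with h | h
    · subst h; simp [PackingLP.q] at hq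
    · exact h
  -- If `n * q ≤ 2` the claimed probability is at most 0. Otherwise `n * q > exp 1`, so `k ≥ m + 1`
  -- and the demands of `m` tied agents together stay below `ε ^ 3 * c j`.
  rcases Nat.lt_or_ge (n * P.q) 3 with h3 | h3
  · refine le_trans (sub_nonpos.2 ?_) (orderProb_nonneg _)
    rw [one_le_div (by positivity)]
    exact_mod_cast (by omega : n * P.q ≤ 2)
  set k : ℝ := (m + 1) * (Real.log n + Real.log P.q) with hk
  have hlog : 1 ≤ Real.log n + Real.log P.q := by
    rw [← Real.log_mul (by positivity) (by positivity), Real.le_log_iff_exp_le (by positivity)]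
    have : (3 : ℝ) ≤ n * P.q := by exact_mod_cast h3
    linarith [Real.exp_one_lt_d9]
  have hmk : (m : ℝ) + 1 ≤ k := by
    rw [hk]; exact le_mul_of_one_le_right (by positivity) hlog
  have hk1 : 1 ≤ k := by linarith [(Nat.cast_nonneg m : (0 : ℝ) ≤ m)]
  have hk0 : 0 < k := by linarith
  have hOPT := P.OPT_nonneg
  have hdiv : ∀ x : ℝ, 0 ≤ x → m * (x / k) ≤ x := fun x hx => by
    rw [mul_div_assoc', div_le_iff₀ hk0, mul_comm]
    gcongr
    linarith
  set Bad : Set (Equiv.Perm (Fin n)) :=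
    ⋃ p ∈ P.patterns v, P.badOrders ε (P.bestOf p) with hBad
  have hprob : orderProb n Bad ≤ 2 / ((n : ℝ) * P.q) := by
    refine (orderProb_biUnion_le _ _).trans (le_trans ?_ (patterns_mul_bad_le (m := m) h3))
    refine (sum_le_sum fun p _ =>
      P.orderProb_badOrders_le hn hε0 hε1 hk1 hw ha (P.bestOf p)).trans ?_
    rw [sum_const, nsmul_eq_mul]
    gcongr
    exact P.card_patterns_le v
  have hcompl := orderProb_compl Bad
  refine le_trans (by linarith) (orderProb_mono (E := Badᶜ) fun π hπ α hα sel hsel => ?_)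
  refine P.allocation_of_not_mem_badOrders hε0 hε1 hgp hv
    (A := fun j => ε ^ 3 * P.c j / k) (W := ε * P.OPT / k)
    (fun j => ?_) (fun i o j => ?_) (fun j => ?_) (by positivity) (fun i o => ?_)
    (hdiv _ (by positivity)) hα (fun hmem => hπ ?_) hsel
  · have := P.c_pos j; positivity
  · rw [le_div_iff₀ hk0]; exact ha i o j
  · have := P.c_pos j; exact hdiv _ (by positivity)
  · rw [le_div_iff₀ hk0]; exact hw i o
  · exact Set.mem_iUnion₂.2 ⟨_, P.pattern_mem_patterns v α, hmem⟩
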